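/- Let $\mathbb M=(M_p)_{p\ge 0}$ be a weight sequence, i.e. a sequence of positive reals with $M_0=1$ and $M_p^2\le M_{p-1}M_{p+1}$ for $p\ge 1$, whose quotients $m_p:=M_{p+1}/M_p$ tend to $\infty$. Put $$\gamma(\mathbb M):=\sup\{\gamma>0:\ \exists a>0\ \forall q\ge p\ge 0,\ \tfrac{m_p}{(p+1)^{\gamma}}\le a\,\tfrac{m_q}{(q+1)^{\gamma}}\}\in[0,\infty]\qquad(\sup\emptyset:=0).$$ Suppose that $\gamma(\mathbb M)>0$ and that $\mathbb M$ satisfies (sm): there are $C_0>0$ and $H>1$ with $\log(m_{p+1}/m_p)\le C_0H^{p+1}$ for all $p\ge 0$. For $r>0$ let $S_r=\{z:\ |\arg z|<r\pi/2\}$, a sector of the Riemann surface of the logarithm. Let $\widetilde{\mathcal A}^u_{(\mathbb M)}(S_r)$ be the space of holomorphic $f:S_r\to\mathbb C$ such that for every $h>0$ there are a formal power series $\sum_{n\ge 0}a_nz^n$ with complex coefficients and a constant $C>0$ with $$\Big|f(z)-\sum_{n=0}^{p-1}a_nz^n\Big|\le C\,h^pM_p|z|^p\qquad\text{for all } z\in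 S_r,\ p\ge 0 .$$ This series is unique and does not depend on $h$, and it belongs to the space $\mathbb C[[z]]_{(\mathbb M)}$ of formal power series $\sum_{p\ge 0} a_pz^p$ with $\sup_{p\ge 0}|a_p|/(h^pM_p)<\infty$ for every $h>0$. The Borel map $\widetilde{\mathcal B}:\widetilde{\mathcal A}^u_{(\mathbb M)}(S_r)\to\mathbb C[[z]]_{(\mathbb M)}$ sends $f$ to this series. Let $\widetilde S^u_{(\mathbb M)}$ be the set of all $r>0$ for which $\widetilde{\mathcal B}:\widetilde{\mathcal A}^u_{(\mathbb M)}(S_r)\to\mathbb C[[z]]_{(\mathbb M)}$ is surjective. Then, for every real $r$ with $0<r<\gamma(\mathbb M)$, the Borel map $\widetilde{\mathcal B}:\widetilde{\mathcal A}^u_{(\mathbb M)}(S_r)\to\mathbb C[[z]]_{(\mathbb M)}$ is surjective; that is, $(0,\gamma(\mathbb M))\subset\widetilde S^u_{(\mathbb M)}$. -/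

import Mathlib

namespace Ultraholomorphic

noncomputable section

open Filter Topology

/-- The sequence of quotients `m_p = M_{p+1} / M_p`. -/
def quotients (M : ℕ → ℝ) (p : ℕ) : ℝ := M (p + 1) / M p

/-- Weight sequences: positive, normalized, log-convex, with quotients tending to infinity. -/
structure IsWeightSequence (M : ℕ → ℝ) : Prop where
  pos : ∀ p, 0 < M p
  zero : M 0 = 1
  logConvex : ∀ p, M (p + 1) ^ 2 ≤ M p * M (p + 2)
  tendsto : Tendsto (quotients M) atTop atTop

/-- The condition (sm): `M` has shifted moments. -/
def HasShiftedMoments (M : ℕ → ℝ) : Prop :=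
  ∃ C₀ : ℝ, 0 < C₀ ∧ ∃ H : ℝ, 1 < H ∧
    ∀ p : ℕ, Real.log (quotients M (p + 1) / quotients M p) ≤ C₀ * H ^ (p + 1)

def AlmostIncreasing (c : ℕ → ℝ) : Prop :=
  ∃ a : ℝ, 0 < a ∧ ∀ p q : ℕ, p ≤ q → c p ≤ a * c q

/-- The index `γ(M) ∈ [0, ∞]`: the supremum of all `γ > 0` such that `m_p / (p+1)^γ` is almost
increasing (the supremum of the empty set being `0`). -/
def gammaIndex (M : ℕ → ℝ) : ENNReal :=
  sSup {t | ∃ γ : ℝ, 0 < γ ∧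
    AlmostIncreasing (fun p => quotients M p / ((p : ℝ) + 1) ^ γ) ∧ t = ENNReal.ofReal γ}

/-- The Riemann surface of the logarithm, in its global holomorphic coordinate `w = log z`:
the point with coordinate `w` has modulus `exp (re w)` and argument `im w`, and lies over the
point `exp w` of the punctured plane. As `exp` is a local biholomorphism, a function on the surface
is holomorphic if and only if it is holomorphic as a function of the coordinate `w`. -/
abbrev LogSurface : Type := ℂ

/-- The projection of the surface onto the punctured plane, `z` seen as a complex number. -/
def LogSurface.proj (w : LogSurface) : ℂ := Complex.exp w

/-- The modulus `|z|` of a point of the surface. -/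
def LogSurface.modulus (w : LogSurface) : ℝ := Real.exp w.re

/-- The argument of a point of the surface, an arbitrary real number. -/
def LogSurface.arg (w : LogSurface) : ℝ := w.im

/-- The unbounded sector `S_γ` of opening `γ π` bisected by direction `0`. -/
def sector (γ : ℝ) : Set LogSurface := {z | |LogSurface.arg z| < γ * Real.pi / 2}

/-- `F` is the uniform `M`-asymptotic expansion of type `1/h` of `f` in `S`. -/
def HasUniformExpansion (M : ℕ → ℝ) (h : ℝ) (S : Set LogSurface) (f : LogSurface → ℂ)
    (F : PowerSeries ℂ) : Prop :=
  ∃ C : ℝ, 0 < C ∧ ∀ p : ℕ, ∀ z ∈ S,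
    ‖f z - ∑ n ∈ Finset.range p, PowerSeries.coeff n F * LogSurface.proj z ^ n‖ ≤
      C * h ^ p * M p * LogSurface.modulus z ^ p

/-- Holomorphic functions on `S` that admit a uniform `M`-asymptotic expansion of type `1/h`.
(A function on `S` is represented by any of its extensions to the surface.) -/
def uniformClass (M : ℕ → ℝ) (h : ℝ) (S : Set LogSurface) : Set (LogSurface → ℂ) :=
  {f | DifferentiableOn ℂ f S ∧ ∃ F : PowerSeries ℂ, HasUniformExpansion M h S f F}

/-- The Beurling class of functions: the intersection of the previous classes over all `h > 0`. -/
def beurlingClass (M : ℕ → ℝ) (S : Set LogSurface) : Set (LogSurface → ℂ) :=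
  {f | ∀ h : ℝ, 0 < h → f ∈ uniformClass M h S}

/-- Formal power series with `sup_p |a_p| / (h^p M_p)` finite. -/
def seriesClass (M : ℕ → ℝ) (h : ℝ) : Set (PowerSeries ℂ) :=
  {F | ∃ C : ℝ, ∀ p : ℕ, ‖PowerSeries.coeff p F‖ ≤ C * (h ^ p * M p)}

/-- The Beurling class of formal power series. -/
def beurlingSeries (M : ℕ → ℝ) : Set (PowerSeries ℂ) :=
  {F | ∀ h : ℝ, 0 < h → F ∈ seriesClass M h}

/-- A uniform expansion in a sector, read along the direction `0`. -/
lemma HasUniformExpansion.on_ray {M : ℕ → ℝ} {h r : ℝ} (hr : 0 < r) {f : LogSurface → ℂ}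
    {F : PowerSeries ℂ} (hF : HasUniformExpansion M h (sector r) f F) :
    ∃ C : ℝ, ∀ p : ℕ, ∀ x : ℝ, 0 < x →
      ‖f (Real.log x) - ∑ n ∈ Finset.range p, PowerSeries.coeff n F * (x : ℂ) ^ n‖ ≤
        C * h ^ p * M p * x ^ p := by
  obtain ⟨C, -, hC⟩ := hF
  refine ⟨C, fun p x hx => ?_⟩
  have hmem : ((Real.log x : ℝ) : ℂ) ∈ sector r := by
    simp only [sector, LogSurface.arg, Set.mem_ofPred_eq, Complex.ofReal_im, abs_zero]
    have := Real.pi_pos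
    positivity
  have h1 := hC p _ hmem
  have e : Complex.exp ((Real.log x : ℝ) : ℂ) = (x : ℂ) := by
    rw [← Complex.ofReal_exp, Real.exp_log hx]
  simpa only [LogSurface.proj, LogSurface.modulus, e, Complex.ofReal_re, Real.exp_log hx] using h1

/-- A number bounded by `B + A x` for all `x > 0` is bounded by `B`. -/
lemma le_of_forall_le_add_mul {a B A : ℝ} (H : ∀ x : ℝ, 0 < x → a ≤ B + A * x) : a ≤ B := by
  have ht : Tendsto (fun x : ℝ => B + A * x) (𝓝[>] 0) (𝓝 B) := by
    have : Tendsto (fun x : ℝ => B + A * x) (𝓝 0) (𝓝 (B + A * 0)) :=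
      (continuous_const.add (continuous_const.mul continuous_id)).tendsto 0
    rw [mul_zero, add_zero] at this
    exact this.mono_left nhdsWithin_le_nhds
  exact ge_of_tendsto ht (eventually_mem_nhdsWithin.mono fun x hx => H x hx)

/-- The coefficients of a uniform expansion satisfy the bounds of the class. -/
lemma HasUniformExpansion.mem_seriesClass {M : ℕ → ℝ} {h r : ℝ} (hr : 0 < r) {f : LogSurface → ℂ}
    {F : PowerSeries ℂ} (hF : HasUniformExpansion M h (sector r) f F) : F ∈ seriesClass M h := by
  obtain ⟨C, hC⟩ := hF.on_ray hr
  refine ⟨C, fun p => ?_⟩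
  refine le_of_forall_le_add_mul (A := C * h ^ (p + 1) * M (p + 1)) fun x hx => ?_
  have h1 := hC p x hx
  have h2 := hC (p + 1) x hx
  rw [Finset.sum_range_succ] at h2
  have h3 : ‖PowerSeries.coeff p F * (x : ℂ) ^ p‖ ≤
      C * h ^ p * M p * x ^ p + C * h ^ (p + 1) * M (p + 1) * x ^ (p + 1) := by
    refine le_trans ?_ (add_le_add h1 h2)
    refine le_trans (le_of_eq ?_) (norm_sub_le _ _)
    congr 1
    ring
  have hxp : 0 < x ^ p := pow_pos hx p
  rw [norm_mul, norm_pow, Complex.norm_real, Real.norm_of_nonneg hx.le] at h3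
  refine le_of_mul_le_mul_right (h3.trans (le_of_eq ?_)) hxp
  ring

/-- The uniform expansion of a function is unique, even between different types. -/
lemma HasUniformExpansion.unique {M : ℕ → ℝ} {h h' r : ℝ} (hr : 0 < r) {f : LogSurface → ℂ}
    {F G : PowerSeries ℂ} (hF : HasUniformExpansion M h (sector r) f F)
    (hG : HasUniformExpansion M h' (sector r) f G) : F = G := by
  obtain ⟨C, hC⟩ := hF.on_ray hr
  obtain ⟨D, hD⟩ := hG.on_ray hr
  ext p
  induction p using Nat.strong_induction_on with
  | _ p ih =>
  have hs : ∀ x : ℂ, ∑ n ∈ Finset.range p, PowerSeries.coeff n F * x ^ n =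
      ∑ n ∈ Finset.range p, PowerSeries.coeff n G * x ^ n := fun x =>
    Finset.sum_congr rfl fun n hn => by rw [ih n (Finset.mem_range.1 hn)]
  have key : ‖PowerSeries.coeff p F - PowerSeries.coeff p G‖ ≤ 0 := by
    refine le_of_forall_le_add_mul
      (A := C * h ^ (p + 1) * M (p + 1) + D * h' ^ (p + 1) * M (p + 1)) fun x hx => ?_
    have h1 := hC (p + 1) x hx
    have h2 := hD (p + 1) x hx
    rw [Finset.sum_range_succ] at h1 h2
    rw [hs] at h1
    have h3 : ‖(PowerSeries.coeff p F - PowerSeries.coeff p G) * (x : ℂ) ^ p‖ ≤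
        D * h' ^ (p + 1) * M (p + 1) * x ^ (p + 1) + C * h ^ (p + 1) * M (p + 1) * x ^ (p + 1) := by
      refine le_trans ?_ (add_le_add h2 h1)
      refine le_trans (le_of_eq ?_) (norm_sub_le _ _)
      congr 1
      ring
    have hxp : 0 < x ^ p := pow_pos hx p
    rw [norm_mul, norm_pow, Complex.norm_real, Real.norm_of_nonneg hx.le] at h3
    refine le_of_mul_le_mul_right (h3.trans (le_of_eq ?_)) hxp
    ring
  exact sub_eq_zero.1 (norm_le_zero_iff.1 key)

/-- A function of the Beurling class has one expansion, of all types. -/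
lemma exists_expansion {M : ℕ → ℝ} {r : ℝ} (hr : 0 < r) {f : LogSurface → ℂ}
    (hf : f ∈ beurlingClass M (sector r)) :
    ∃ F : PowerSeries ℂ, ∀ h : ℝ, 0 < h → HasUniformExpansion M h (sector r) f F := by
  obtain ⟨-, F, hF⟩ := hf 1 one_pos
  refine ⟨F, fun h hh => ?_⟩
  obtain ⟨-, G, hG⟩ := hf h hh
  rwa [hF.unique hr hG]

/-- The asymptotic Borel map between Beurling classes on `S_r`, sending a function to its uniform
asymptotic expansion. -/
def borelMap (M : ℕ → ℝ) (r : ℝ) (hr : 0 < r) (f : beurlingClass M (sector r)) :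
    beurlingSeries M :=
  ⟨(exists_expansion hr f.2).choose, fun h hh =>
    ((exists_expansion hr f.2).choose_spec h hh).mem_seriesClass hr⟩

/-- The surjectivity interval of the Borel map for the Beurling classes. -/
def surjectivityInterval (M : ℕ → ℝ) : Set ℝ :=
  {γ | ∃ hγ : 0 < γ, Function.Surjective (borelMap M γ hγ)}

end

end Ultraholomorphic

namespace Ultraholomorphic

noncomputable section

open Filter Topology MeasureTheory

/-! ### The kernel -/

/-! Choose `γ > r` for which `m_p / (p+1)^γ` is almost increasing. `exists_smaller_quotients`
replaces `m` by `n = θ μ`: here `μ` is equivalent to `m` with `μ_p / (p+1)^γ` increasing, and `θ`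
tends to 0, but slowly enough to preserve growth of order above `r`. With `N_p = n_0 ⋯ n_{p-1}`, the
given coefficients are still `O(N_p)`, while `N_p = O(t^p M_p)` for every `t > 0`. A function with
remainders `O(A^p N_p |z|^p)` for one single `A` therefore has expansions of all types relative to
`M`.

`exists_expansion_of_growth` produces such a function as a truncated Laplace transform `a_0 + ∫
e(t/z) G(t) dt/t`, written with `t = exp x`, whose kernel is `e(z) = ∏ (1 + (z/n_k)^(1/r))^(-r)`. On
the sector each `(z/n_k)^(1/r)` has positive real part, whence `|e(z)| ≤ N_j |z|^(-j)` for every `j`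
(`norm_kernel_le`). The growth of `n` bounds `e(n_p)` from below, so the moments of positive order
dominate `N_p` up to a geometric factor (`le_moment`), and dividing the coefficients by the moments
yields a convergent series, whose truncation is `G`. The transform sends monomials to moments times
monomials (`integral_kernel_mul_exp`), so a remainder of `f` is the transform of a remainder of `G`.
Its bound has the extra factor `2 + log (n_{p+1}/n_p)` (`integral_kernel_mul_le`), which (sm) makes
at most geometric. -/

lemma isOpen_sector (r : ℝ) : IsOpen (sector r) :=
  isOpen_lt (continuous_abs.comp Complex.continuous_im) continuous_const

lemma mem_sector {r : ℝ} {w : ℂ} : w ∈ sector r ↔ |w.im| < r * Real.pi / 2 := Iff.rfl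

lemma ofReal_mem_sector {r : ℝ} (hr : 0 < r) (x : ℝ) : (x : ℂ) ∈ sector r := by
  have := Real.pi_pos
  rw [mem_sector, Complex.ofReal_im, abs_zero]
  positivity

lemma ofReal_sub_mem_sector {r : ℝ} {w : ℂ} (hw : w ∈ sector r) (x : ℝ) :
    (x : ℂ) - w ∈ sector r := by
  rw [mem_sector] at hw ⊢
  simpa using hw

/-- Mean value inequality on the half-plane, where the derivative `1 / (1 + z)` has modulus at most
1. No smallness of `v` is required. -/
lemma norm_log_one_add_le_of_re_nonneg {v : ℂ} (hv : 0 ≤ v.re) :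
    ‖Complex.log (1 + v)‖ ≤ ‖v‖ := by
  have hs : Convex ℝ {z : ℂ | 0 ≤ z.re} := convex_halfSpace_re_ge 0
  have hd : ∀ z ∈ {z : ℂ | 0 ≤ z.re},
      HasDerivWithinAt (fun z => Complex.log (1 + z)) (1 / (1 + z)) {z : ℂ | 0 ≤ z.re} z := by
    intro z hz
    have hz : 0 ≤ z.re := hz
    refine (((hasDerivAt_id z).const_add 1).clog ?_).hasDerivWithinAt
    left
    simp only [id, Complex.add_re, Complex.one_re]
    linarith
  have hb : ∀ z ∈ {z : ℂ | 0 ≤ z.re}, ‖1 / (1 + z)‖ ≤ 1 := by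
    intro z hz
    have hz : 0 ≤ z.re := hz
    have h1 : 1 ≤ ‖1 + z‖ := by
      refine le_trans ?_ (Complex.re_le_norm _)
      simp only [Complex.add_re, Complex.one_re]
      linarith
    rw [norm_div, norm_one]
    exact div_le_one_of_le₀ h1 (norm_nonneg _)
  have := hs.norm_image_sub_le_of_norm_hasDerivWithin_le hd hb
    (show (0 : ℂ) ∈ {z : ℂ | 0 ≤ z.re} by simp) (show v ∈ {z : ℂ | 0 ≤ z.re} from hv)
  simpa using this

/-- The `k`-th factor is a holomorphic branch of `(1 + (z / n_k) ^ (1 / r)) ^ (-r)`, where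
`z = exp w` and `n_k = exp (l k)`. -/
def kernel (r : ℝ) (l : ℕ → ℝ) (w : ℂ) : ℂ :=
  Complex.exp (-r * ∑' k, Complex.log (1 + Complex.exp ((w - l k) / r)))

/-- The power `1 / r` opens the sector exactly onto the right half-plane, which is why the kernel is
adapted to the opening `r`. -/
lemma re_exp_div_pos {r : ℝ} (hr : 0 < r) {w : ℂ} (hw : w ∈ sector r) (a : ℝ) :
    0 < (Complex.exp ((w - a) / r)).re := by
  rw [Complex.exp_re]
  refine mul_pos (Real.exp_pos _) (Real.cos_pos_of_mem_Ioo ?_)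
  rw [Complex.div_ofReal_im, Complex.sub_im, Complex.ofReal_im, sub_zero, Set.mem_Ioo,
    lt_div_iff₀ hr, div_lt_iff₀ hr]
  have := abs_lt.1 (mem_sector.1 hw)
  constructor <;> linarith

lemma norm_exp_div (r : ℝ) (w : ℂ) (a : ℝ) :
    ‖Complex.exp ((w - a) / r)‖ = Real.exp ((w.re - a) / r) := by
  rw [Complex.norm_exp, Complex.div_ofReal_re, Complex.sub_re, Complex.ofReal_re]

lemma norm_log_factor_le {r : ℝ} (hr : 0 < r) {w : ℂ} (hw : w ∈ sector r) (a : ℝ) :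
    ‖Complex.log (1 + Complex.exp ((w - a) / r))‖ ≤ Real.exp (w.re / r) * Real.exp (-a / r) := by
  refine (norm_log_one_add_le_of_re_nonneg (re_exp_div_pos hr hw a).le).trans (le_of_eq ?_)
  rw [norm_exp_div, ← Real.exp_add]
  ring_nf

lemma summable_log_factor {r : ℝ} (hr : 0 < r) {l : ℕ → ℝ}
    (hl : Summable fun k => Real.exp (-l k / r)) {w : ℂ} (hw : w ∈ sector r) :
    Summable fun k => Complex.log (1 + Complex.exp ((w - l k) / r)) :=
  Summable.of_norm_bounded (hl.mul_left _) fun k => norm_log_factor_le hr hw (l k)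

lemma differentiableOn_kernel {r : ℝ} (hr : 0 < r) {l : ℕ → ℝ}
    (hl : Summable fun k => Real.exp (-l k / r)) : DifferentiableOn ℂ (kernel r l) (sector r) := by
  intro w₀ hw₀
  -- The terms are dominated uniformly only where `w.re` is bounded above.
  have hU : IsOpen (sector r ∩ {w : ℂ | w.re < w₀.re + 1}) :=
    (isOpen_sector r).inter (isOpen_lt Complex.continuous_re continuous_const)
  have hd : DifferentiableOn ℂ
      (fun w : ℂ => ∑' k, Complex.log (1 + Complex.exp ((w - l k) / r)))
      (sector r ∩ {w : ℂ | w.re < w₀.re + 1}) := by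
    refine Complex.differentiableOn_tsum_of_summable_norm
      (F := fun k w => Complex.log (1 + Complex.exp ((w - l k) / r)))
      (hl.mul_left (Real.exp ((w₀.re + 1) / r))) (fun k w hw => ?_) hU fun k w hw => ?_
    · have hf : DifferentiableAt ℂ (fun w : ℂ => 1 + Complex.exp ((w - l k) / r)) w := by
        simp only [div_eq_mul_inv]
        fun_prop
      refine (hf.clog ?_).differentiableWithinAt
      left
      have := re_exp_div_pos hr hw.1 (l k)
      simp only [Complex.add_re, Complex.one_re]
      linarith
    · refine (norm_log_factor_le hr hw.1 (l k)).trans ?_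
      have : w.re < w₀.re + 1 := hw.2
      gcongr
  have hmem : w₀ ∈ sector r ∩ {w : ℂ | w.re < w₀.re + 1} := ⟨hw₀, by simp⟩
  have := (hd.differentiableAt (hU.mem_nhds hmem)).const_mul (-(r : ℂ))
  exact this.cexp.differentiableWithinAt

/-- For `Re v > 0` one has `|1 + v| ≥ max 1 |v|`. Use `|v|` for the first `j` factors and 1 for the
others; the outer exponent `-r` cancels the inner `1 / r`. -/
lemma norm_kernel_le {r : ℝ} (hr : 0 < r) {l : ℕ → ℝ}
    (hl : Summable fun k => Real.exp (-l k / r)) {w : ℂ} (hw : w ∈ sector r) (j : ℕ) :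
    ‖kernel r l w‖ ≤ Real.exp (∑ k ∈ Finset.range j, l k - j * w.re) := by
  have hs := summable_log_factor hr hl hw
  have hre : (∑' k, Complex.log (1 + Complex.exp ((w - l k) / r))).re =
      ∑' k, Real.log ‖1 + Complex.exp ((w - l k) / r)‖ := by
    rw [Complex.re_tsum hs]
    simp only [Complex.log_re]
  have hsr : Summable fun k => Real.log ‖1 + Complex.exp ((w - l k) / r)‖ := by
    have := (Complex.hasSum_re hs.hasSum).summable
    simpa only [Complex.log_re] using this
  have h0 : ∀ k, 0 ≤ Real.log ‖1 + Complex.exp ((w - l k) / r)‖ := by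
    intro k
    refine Real.log_nonneg (le_trans ?_ (Complex.re_le_norm _))
    have := re_exp_div_pos hr hw (l k)
    simp only [Complex.add_re, Complex.one_re]
    linarith
  have h1 : ∀ k, (w.re - l k) / r ≤ Real.log ‖1 + Complex.exp ((w - l k) / r)‖ := by
    intro k
    rw [← Real.log_exp ((w.re - l k) / r), ← norm_exp_div]
    refine Real.log_le_log (by rw [norm_exp_div]; positivity) ?_
    have := re_exp_div_pos hr hw (l k)
    rw [← sq_le_sq₀ (norm_nonneg _) (norm_nonneg _), Complex.sq_norm, Complex.sq_norm,
      Complex.normSq_apply, Complex.normSq_apply]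
    simp only [Complex.add_re, Complex.one_re, Complex.add_im, Complex.one_im]
    nlinarith
  rw [kernel, Complex.norm_exp]
  refine Real.exp_le_exp.2 ?_
  rw [← Complex.ofReal_neg, Complex.re_ofReal_mul, hre]
  have h2 : ∑ k ∈ Finset.range j, (w.re - l k) / r ≤
      ∑' k, Real.log ‖1 + Complex.exp ((w - l k) / r)‖ :=
    (Finset.sum_le_sum fun k _ => h1 k).trans (hsr.sum_le_tsum _ fun k _ => h0 k)
  rw [← Finset.sum_div, div_le_iff₀ hr, Finset.sum_sub_distrib, Finset.sum_const,
    Finset.card_range, nsmul_eq_mul] at h2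
  linarith

/-- The values of the kernel on the real axis. -/
def realKernel (r : ℝ) (l : ℕ → ℝ) (x : ℝ) : ℝ :=
  Real.exp (-r * ∑' k, Real.log (1 + Real.exp ((x - l k) / r)))

lemma kernel_ofReal (r : ℝ) (l : ℕ → ℝ) (x : ℝ) : kernel r l x = (realKernel r l x : ℂ) := by
  have h : ∀ k, Complex.log (1 + Complex.exp (((x : ℂ) - l k) / r)) =
      ((Real.log (1 + Real.exp ((x - l k) / r)) : ℝ) : ℂ) := by
    intro k
    rw [Complex.ofReal_log (by positivity)]
    push_cast
    rfl
  rw [kernel, realKernel]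
  simp only [h]
  push_cast
  rfl

lemma summable_real_log_factor {r : ℝ} {l : ℕ → ℝ}
    (hl : Summable fun k => Real.exp (-l k / r)) (x : ℝ) :
    Summable fun k => Real.log (1 + Real.exp ((x - l k) / r)) := by
  refine Summable.of_nonneg_of_le (fun k => Real.log_nonneg ?_) (fun k => ?_)
    (hl.mul_left (Real.exp (x / r)))
  · have := Real.exp_pos ((x - l k) / r)
    linarith
  · have h := Real.log_le_sub_one_of_pos (show 0 < 1 + Real.exp ((x - l k) / r) by positivity)
    rw [← Real.exp_add]
    refine h.trans (le_of_eq ?_)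
    ring_nf

lemma antitone_realKernel {r : ℝ} (hr : 0 < r) {l : ℕ → ℝ}
    (hl : Summable fun k => Real.exp (-l k / r)) : Antitone (realKernel r l) := by
  intro x y hxy
  refine Real.exp_le_exp.2 (mul_le_mul_of_nonpos_left ?_ (by linarith))
  refine (summable_real_log_factor hl x).tsum_le_tsum (fun k => ?_) (summable_real_log_factor hl y)
  gcongr

/-! ### Holomorphic convolutions -/

/-- Cauchy's estimate on circles of radius `ε / 2` turns the domination of the integrand into one of
its derivative in `w`, so no bound on `deriv E` has to be supplied. -/
lemma differentiableOn_integral_comp_sub {r : ℝ} {E : ℂ → ℂ} (hE : DifferentiableOn ℂ E (sector r))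
    {g : ℝ → ℂ} (hg : AEStronglyMeasurable g) {U : Set ℂ} (hU : IsOpen U) (hUr : U ⊆ sector r)
    {b : ℝ → ℝ} (hb : Integrable b) (hbd : ∀ w ∈ U, ∀ x : ℝ, ‖E (x - w) * g x‖ ≤ b x) :
    DifferentiableOn ℂ (fun w => ∫ x : ℝ, E (x - w) * g x) U := by
  intro w₀ hw₀
  obtain ⟨ε, hε, hball⟩ := Metric.isOpen_iff.1 hU w₀ hw₀
  have hcont : ∀ {F : ℂ → ℂ}, ContinuousOn F (sector r) → ∀ w ∈ U,
      AEStronglyMeasurable fun x : ℝ => F (x - w) * g x := by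
    intro F hF w hw
    refine AEStronglyMeasurable.mul (Continuous.aestronglyMeasurable ?_) hg
    exact hF.comp_continuous (by fun_prop) fun x => ofReal_sub_mem_sector (hUr hw) x
  have hdw : ∀ x : ℝ, ∀ w ∈ U,
      HasDerivAt (fun w => E (x - w) * g x) (-deriv E (x - w) * g x) w := by
    intro x w hw
    have h1 := (hE.differentiableAt ((isOpen_sector r).mem_nhds
      (ofReal_sub_mem_sector (hUr hw) x))).hasDerivAt
    have h2 := h1.comp w ((hasDerivAt_id w).const_sub (x : ℂ))
    simpa using h2.mul_const (g x)
  have hint : ∀ w ∈ U, Integrable fun x : ℝ => E (x - w) * g x := fun w hw =>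
    hb.mono' (hcont hE.continuousOn w hw) (Eventually.of_forall (hbd w hw))
  have hmain := hasDerivAt_integral_of_dominated_loc_of_deriv_le (μ := volume)
    (F := fun w (x : ℝ) => E (x - w) * g x) (F' := fun w (x : ℝ) => -deriv E (x - w) * g x)
    (x₀ := w₀) (s := Metric.ball w₀ (ε / 2)) (bound := fun x => b x / (ε / 2))
    (Metric.ball_mem_nhds _ (by positivity))
    (by filter_upwards [hU.mem_nhds hw₀] with w hw using hcont hE.continuousOn w hw)
    (hint w₀ hw₀)
    (hcont ((hE.deriv (isOpen_sector r)).continuousOn.neg) w₀ hw₀)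
    (Eventually.of_forall fun x w hw => by
      have hsub : Metric.closedBall w (ε / 2) ⊆ U := by
        refine subset_trans (fun z hz => ?_) hball
        rw [Metric.mem_ball] at hw ⊢
        rw [Metric.mem_closedBall] at hz
        linarith [dist_triangle z w w₀]
      rw [← (hdw x w (hsub (Metric.mem_closedBall_self (by positivity)))).deriv]
      refine Complex.norm_deriv_le_of_forall_mem_sphere_norm_le (by positivity) ?_ fun z hz =>
        hbd z (hsub (Metric.sphere_subset_closedBall hz)) x
      refine DifferentiableOn.diffContOnCl_ball (U := U) (fun z hz => ?_) hsub
      exact (hdw x z hz).differentiableAt.differentiableWithinAt)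
    (hb.div_const _)
    (Eventually.of_forall fun x w hw => hdw x w (hball
      (Metric.ball_subset_ball (by linarith) hw)))
  exact hmain.2.differentiableAt.differentiableWithinAt

/-! ### Moments of the kernel -/

/-- Telescoping form of comparing `∑ j^(-(q+1))` with an integral, obtained from `log s ≤ s - 1` and
`1 + s ≤ exp s`. -/
lemma rpow_neg_telescope {q : ℝ} (hq : 0 < q) {x : ℝ} (hx : 0 < x) :
    q * (x + 1) ^ (-(q + 1)) ≤ x ^ (-q) - (x + 1) ^ (-q) := by
  have h1 : Real.log (x / (x + 1)) ≤ -(1 / (x + 1)) := by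
    refine (Real.log_le_sub_one_of_pos (by positivity)).trans (le_of_eq ?_)
    field_simp
    ring
  rw [Real.log_div (by positivity) (by positivity)] at h1
  have h2 : (x + 1) ^ (-q) * (1 + q / (x + 1)) ≤ x ^ (-q) := by
    rw [Real.rpow_def_of_pos hx, Real.rpow_def_of_pos (by positivity : 0 < x + 1)]
    calc _ ≤ Real.exp (Real.log (x + 1) * -q) * Real.exp (q / (x + 1)) := by
          gcongr
          linarith [Real.add_one_le_exp (q / (x + 1))]
      _ ≤ _ := by
          rw [← Real.exp_add]
          refine Real.exp_le_exp.2 ?_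
          have := mul_le_mul_of_nonneg_left h1 hq.le
          have e : q / (x + 1) = q * (1 / (x + 1)) := by ring
          rw [e]
          linarith
  have h3 : (x + 1) ^ (-(q + 1)) = (x + 1) ^ (-q) / (x + 1) := by
    rw [neg_add, ← sub_eq_add_neg, Real.rpow_sub_one (by positivity)]
  rw [h3]
  have e : (x + 1) ^ (-q) * (1 + q / (x + 1)) = (x + 1) ^ (-q) + q * ((x + 1) ^ (-q) / (x + 1)) := by
    ring
  linarith

/-- Linearity in `x` is what matters: with `x = p + 1`, exponentiating this bound costs only a
geometric factor. -/
lemma tsum_rpow_tail_le {κ : ℝ} (hκ : 1 < κ) {x : ℝ} (hx : 0 < x) :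
    ∑' j : ℕ, (x / (x + j + 1)) ^ κ ≤ x / (κ - 1) := by
  have hκ' : 0 < κ - 1 := by linarith
  refine Real.tsum_le_of_sum_range_le (fun j => by positivity) fun n => ?_
  have h : ∀ j ∈ Finset.range n, (x / (x + j + 1)) ^ κ ≤
      x ^ κ / (κ - 1) * ((x + j) ^ (-(κ - 1)) - (x + (j + 1 : ℕ)) ^ (-(κ - 1))) := by
    intro j _
    have h1 := rpow_neg_telescope hκ' (show 0 < x + j by positivity)
    rw [sub_add_cancel] at h1
    have e : (x / (x + j + 1)) ^ κ = x ^ κ / (κ - 1) * ((κ - 1) * (x + j + 1) ^ (-κ)) := by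
      rw [Real.div_rpow hx.le (by positivity), Real.rpow_neg (by positivity)]
      field_simp
    rw [e]
    have e2 : x + ((j + 1 : ℕ) : ℝ) = x + j + 1 := by push_cast; ring
    rw [e2]
    gcongr
  refine (Finset.sum_le_sum h).trans ?_
  rw [← Finset.mul_sum, Finset.sum_range_sub' (fun j : ℕ => (x + j) ^ (-(κ - 1)))]
  have h0 : 0 ≤ (x + n) ^ (-(κ - 1)) := by positivity
  calc x ^ κ / (κ - 1) * ((x + (0 : ℕ)) ^ (-(κ - 1)) - (x + n) ^ (-(κ - 1)))
      ≤ x ^ κ / (κ - 1) * x ^ (-(κ - 1)) := by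
        gcongr
        rw [Nat.cast_zero, add_zero]
        linarith
    _ = x / (κ - 1) := by
        rw [div_mul_eq_mul_div, ← Real.rpow_add hx]
        congr 1
        rw [show κ + -(κ - 1) = 1 by ring, Real.rpow_one]

lemma summable_one_add_div_rpow {κ : ℝ} (hκ : 1 < κ) :
    Summable fun k : ℕ => (1 / ((k : ℝ) + 1)) ^ κ := by
  have h := (summable_nat_add_iff 1).2 (Real.summable_nat_rpow_inv.2 hκ)
  refine h.congr fun k => ?_
  rw [one_div, Real.inv_rpow (by positivity)]
  push_cast
  rfl

lemma summable_exp_neg {r κ : ℝ} (hκ : 1 < κ) {l : ℕ → ℝ}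
    (hl : ∀ p q : ℕ, p ≤ q → Real.exp ((l p - l q) / r) ≤ (((p : ℝ) + 1) / (q + 1)) ^ κ) :
    Summable fun k => Real.exp (-l k / r) := by
  refine Summable.of_nonneg_of_le (fun k => (Real.exp_pos _).le) (fun k => ?_)
    ((summable_one_add_div_rpow hκ).mul_left (Real.exp (-l 0 / r)))
  have h := hl 0 k (Nat.zero_le k)
  rw [Nat.cast_zero, zero_add] at h
  calc Real.exp (-l k / r) = Real.exp (-l 0 / r) * Real.exp ((l 0 - l k) / r) := by
        rw [← Real.exp_add]
        ring_nf
    _ ≤ _ := by gcongr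

lemma monotone_of_growth {r κ : ℝ} (hr : 0 < r) (hκ : 1 < κ) {l : ℕ → ℝ}
    (hl : ∀ p q : ℕ, p ≤ q → Real.exp ((l p - l q) / r) ≤ (((p : ℝ) + 1) / (q + 1)) ^ κ) :
    Monotone l := by
  intro p q hpq
  have hpq' : (p : ℝ) ≤ q := by exact_mod_cast hpq
  have h1 : (((p : ℝ) + 1) / (q + 1)) ^ κ ≤ 1 :=
    Real.rpow_le_one (by positivity) (div_le_one_of_le₀ (by linarith) (by positivity)) (by linarith)
  have h2 := Real.exp_le_one_iff.1 ((hl p q hpq).trans h1)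
  rw [div_le_iff₀ hr] at h2
  linarith

/-- For `k ≤ p` the base of the `k`-th factor is at most `2 exp ((l p - l k) / r)`; for `k > p` use
`log (1 + s) ≤ s` and the growth of `l`. Both errors are linear in `p + 1`. -/
lemma le_realKernel {r κ : ℝ} (hr : 0 < r) (hκ : 1 < κ) {l : ℕ → ℝ}
    (hl : ∀ p q : ℕ, p ≤ q → Real.exp ((l p - l q) / r) ≤ (((p : ℝ) + 1) / (q + 1)) ^ κ) (p : ℕ) :
    Real.exp (∑ k ∈ Finset.range (p + 1), l k - (p + 1) * l p
      - (p + 1) * (r * Real.log 2 + r / (κ - 1))) ≤ realKernel r l (l p) := by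
  have hs := summable_exp_neg hκ hl
  have hmono := monotone_of_growth hr hκ hl
  have hsum := summable_real_log_factor hs (l p)
  have h1 : ∑ k ∈ Finset.range (p + 1), Real.log (1 + Real.exp ((l p - l k) / r)) ≤
      ∑ k ∈ Finset.range (p + 1), (Real.log 2 + (l p - l k) / r) := by
    refine Finset.sum_le_sum fun k hk => ?_
    have hk' : l k ≤ l p := hmono (Nat.lt_succ_iff.1 (Finset.mem_range.1 hk))
    have h0 : 1 ≤ Real.exp ((l p - l k) / r) :=
      Real.one_le_exp (div_nonneg (by linarith) hr.le)
    rw [← Real.log_exp ((l p - l k) / r), ← Real.log_mul two_ne_zero (Real.exp_pos _).ne',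
      Real.log_exp]
    exact Real.log_le_log (by positivity) (by linarith)
  have h2 : ∑' j, Real.log (1 + Real.exp ((l p - l (j + (p + 1))) / r)) ≤
      ((p : ℝ) + 1) / (κ - 1) := by
    refine le_trans ?_ (tsum_rpow_tail_le hκ (show 0 < (p : ℝ) + 1 by positivity))
    refine ((summable_nat_add_iff (p + 1)).2 hsum).tsum_le_tsum (fun j => ?_) ?_
    · refine (Real.log_le_sub_one_of_pos (by positivity)).trans ?_
      rw [add_sub_cancel_left]
      refine (hl p (j + (p + 1)) (by omega)).trans (le_of_eq ?_)
      push_cast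
      ring_nf
    · have := ((summable_nat_add_iff (p + 1)).2 (summable_one_add_div_rpow hκ)).mul_left
        (((p : ℝ) + 1) ^ κ)
      refine this.congr fun j => ?_
      rw [← Real.mul_rpow (by positivity) (by positivity)]
      push_cast
      congr 1
      rw [mul_one_div]
      congr 1
      ring
  rw [realKernel]
  refine Real.exp_le_exp.2 ?_
  rw [← hsum.sum_add_tsum_nat_add (p + 1)]
  rw [Finset.sum_add_distrib, ← Finset.sum_div, Finset.sum_sub_distrib, Finset.sum_const,
    Finset.sum_const, Finset.card_range, nsmul_eq_mul, nsmul_eq_mul] at h1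
  have h3 := mul_le_mul_of_nonneg_left (add_le_add h1 h2) hr.le
  have e : r * ((((p + 1 : ℕ) : ℝ) * Real.log 2 +
        (((p + 1 : ℕ) : ℝ) * l p - ∑ k ∈ Finset.range (p + 1), l k) / r) + ((p : ℝ) + 1) / (κ - 1)) =
      -(∑ k ∈ Finset.range (p + 1), l k - (p + 1) * l p
      - (p + 1) * (r * Real.log 2 + r / (κ - 1))) := by
    push_cast
    field_simp
    ring
  linarith

/-- A function equal to `1` on `(a, b]`, decaying exponentially outside. -/
def plateau (a b x : ℝ) : ℝ :=
  (Set.Iic a).indicator (fun x => Real.exp (-a) * Real.exp x) x +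
    (Set.Ioc a b).indicator (fun _ => (1 : ℝ)) x +
    (Set.Ioi b).indicator (fun x => Real.exp b * Real.exp (-x)) x

lemma exp_le_plateau {a b x : ℝ} (hx : x ≤ a) : Real.exp (x - a) ≤ plateau a b x := by
  have h1 : 0 ≤ (Set.Ioc a b).indicator (fun _ => (1 : ℝ)) x :=
    Set.indicator_nonneg (fun _ _ => by positivity) _
  have h2 : 0 ≤ (Set.Ioi b).indicator (fun x => Real.exp b * Real.exp (-x)) x :=
    Set.indicator_nonneg (fun _ _ => by positivity) _
  rw [plateau, Set.indicator_of_mem (Set.mem_Iic.2 hx), ← Real.exp_add]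
  rw [show -a + x = x - a by ring]
  linarith

lemma one_le_plateau {a b x : ℝ} (ha : a < x) (hb : x ≤ b) : 1 ≤ plateau a b x := by
  have h1 : 0 ≤ (Set.Iic a).indicator (fun x => Real.exp (-a) * Real.exp x) x :=
    Set.indicator_nonneg (fun _ _ => by positivity) _
  have h2 : 0 ≤ (Set.Ioi b).indicator (fun x => Real.exp b * Real.exp (-x)) x :=
    Set.indicator_nonneg (fun _ _ => by positivity) _
  rw [plateau, Set.indicator_of_mem (show x ∈ Set.Ioc a b from ⟨ha, hb⟩)]
  linarith

lemma exp_le_plateau' {a b x : ℝ} (hx : b < x) : Real.exp (b - x) ≤ plateau a b x := by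
  have h1 : 0 ≤ (Set.Ioc a b).indicator (fun _ => (1 : ℝ)) x :=
    Set.indicator_nonneg (fun _ _ => by positivity) _
  have h2 : 0 ≤ (Set.Iic a).indicator (fun x => Real.exp (-a) * Real.exp x) x :=
    Set.indicator_nonneg (fun _ _ => by positivity) _
  rw [plateau, Set.indicator_of_mem (Set.mem_Ioi.2 hx), ← Real.exp_add, ← sub_eq_add_neg]
  linarith

lemma integrable_plateau_parts (a b : ℝ) :
    Integrable ((Set.Iic a).indicator fun x => Real.exp (-a) * Real.exp x) ∧
    Integrable ((Set.Ioc a b).indicator fun _ => (1 : ℝ)) ∧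
    Integrable ((Set.Ioi b).indicator fun x => Real.exp b * Real.exp (-x)) := by
  refine ⟨?_, ?_, ?_⟩
  · exact (integrable_indicator_iff measurableSet_Iic).2 ((integrableOn_exp_Iic a).const_mul _)
  · exact (integrable_indicator_iff measurableSet_Ioc).2 (integrableOn_const (by simp))
  · refine (integrable_indicator_iff measurableSet_Ioi).2 (Integrable.const_mul ?_ _)
    simpa [IntegrableOn] using exp_neg_integrableOn_Ioi b one_pos

lemma integrable_plateau (a b : ℝ) : Integrable (plateau a b) :=
  ((integrable_plateau_parts a b).1.add (integrable_plateau_parts a b).2.1).add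
    (integrable_plateau_parts a b).2.2

lemma integral_plateau {a b : ℝ} (hab : a ≤ b) : ∫ x, plateau a b x = 2 + (b - a) := by
  obtain ⟨h1, h2, h3⟩ := integrable_plateau_parts a b
  have e : ∫ x, plateau a b x =
      ∫ x, (((Set.Iic a).indicator (fun x => Real.exp (-a) * Real.exp x) +
        (Set.Ioc a b).indicator (fun _ => (1 : ℝ))) +
        (Set.Ioi b).indicator (fun x => Real.exp b * Real.exp (-x))) x := rfl
  rw [e, integral_add' (h1.add h2) h3, integral_add' h1 h2, integral_indicator measurableSet_Iic,
    integral_indicator measurableSet_Ioc, integral_indicator measurableSet_Ioi,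
    integral_const_mul, integral_const_mul, integral_exp_Iic, integral_exp_neg_Ioi, ← Real.exp_add,
    ← Real.exp_add]
  simp [hab]
  ring

/-- `norm_kernel_le` with `j = p`, `p + 1`, `p + 2` gives growth like `exp x` left of `l p`, a
constant between `l p` and `l (p + 1)`, and decay like `exp (-x)` to the right. The constant stretch
produces the term `l (p + 1) - l p` in the integral. -/
lemma norm_kernel_mul_exp_le {r : ℝ} (hr : 0 < r) {l : ℕ → ℝ}
    (hl : Summable fun k => Real.exp (-l k / r)) {w : ℂ} (hw : w ∈ sector r) (p : ℕ) (x : ℝ) :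
    ‖kernel r l (x - w)‖ * Real.exp ((p + 1) * x) ≤
      Real.exp (∑ k ∈ Finset.range (p + 1), l k + (p + 1) * w.re) *
        plateau (l p) (l (p + 1)) (x - w.re) := by
  have hk := norm_kernel_le hr hl (ofReal_sub_mem_sector hw x)
  have key : ∀ j : ℕ, ∀ t : ℝ, ∑ k ∈ Finset.range j, l k - j * (x - w.re) + (p + 1) * x ≤
      ∑ k ∈ Finset.range (p + 1), l k + (p + 1) * w.re + t →
      Real.exp t ≤ plateau (l p) (l (p + 1)) (x - w.re) →
      ‖kernel r l (x - w)‖ * Real.exp ((p + 1) * x) ≤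
      Real.exp (∑ k ∈ Finset.range (p + 1), l k + (p + 1) * w.re) *
        plateau (l p) (l (p + 1)) (x - w.re) := by
    intro j t h1 h2
    have h3 := hk j
    rw [Complex.sub_re, Complex.ofReal_re] at h3
    calc _ ≤ Real.exp (∑ k ∈ Finset.range j, l k - j * (x - w.re)) * Real.exp ((p + 1) * x) := by
          gcongr
      _ ≤ Real.exp (∑ k ∈ Finset.range (p + 1), l k + (p + 1) * w.re) * Real.exp t := by
          rw [← Real.exp_add, ← Real.exp_add]
          exact Real.exp_le_exp.2 h1
      _ ≤ _ := by gcongr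
  rcases le_or_gt (x - w.re) (l p) with h | h
  · refine key p _ (le_of_eq ?_) (exp_le_plateau h)
    rw [Finset.sum_range_succ]
    ring
  rcases le_or_gt (x - w.re) (l (p + 1)) with h' | h'
  · refine key (p + 1) 0 (le_of_eq ?_) (by rw [Real.exp_zero]; exact one_le_plateau h h')
    push_cast
    ring
  · refine key (p + 2) _ (le_of_eq ?_) (exp_le_plateau' h')
    rw [Finset.sum_range_succ _ (p + 1)]
    push_cast
    ring

lemma continuous_kernel_sub {r : ℝ} (hr : 0 < r) {l : ℕ → ℝ}
    (hl : Summable fun k => Real.exp (-l k / r)) {w : ℂ} (hw : w ∈ sector r) :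
    Continuous fun x : ℝ => kernel r l (x - w) :=
  (differentiableOn_kernel hr hl).continuousOn.comp_continuous (by fun_prop)
    fun x => ofReal_sub_mem_sector hw x

/-- A function with `‖g x‖ ≤ B exp ((p + 1) x)` has a convolution with the kernel that is bounded
by a multiple of the `(p + 1)`-st power of the modulus. -/
lemma integral_kernel_mul_le {r κ : ℝ} (hr : 0 < r) (hκ : 1 < κ) {l : ℕ → ℝ}
    (hl : ∀ p q : ℕ, p ≤ q → Real.exp ((l p - l q) / r) ≤ (((p : ℝ) + 1) / (q + 1)) ^ κ)
    {w : ℂ} (hw : w ∈ sector r) (p : ℕ) {g : ℝ → ℂ} (hg : AEStronglyMeasurable g) {B : ℝ}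
    (hgB : ∀ x, ‖g x‖ ≤ B * Real.exp ((p + 1) * x)) :
    Integrable (fun x : ℝ => kernel r l (x - w) * g x) ∧
    ‖∫ x : ℝ, kernel r l (x - w) * g x‖ ≤
      B * Real.exp (∑ k ∈ Finset.range (p + 1), l k + (p + 1) * w.re) *
        (2 + (l (p + 1) - l p)) := by
  have hs := summable_exp_neg hκ hl
  have hB : 0 ≤ B := nonneg_of_mul_nonneg_left ((norm_nonneg _).trans (hgB 0)) (Real.exp_pos _)
  have hbd : ∀ x : ℝ, ‖kernel r l (x - w) * g x‖ ≤
      B * Real.exp (∑ k ∈ Finset.range (p + 1), l k + (p + 1) * w.re) *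
        plateau (l p) (l (p + 1)) (x - w.re) := by
    intro x
    rw [norm_mul]
    calc _ ≤ ‖kernel r l (x - w)‖ * (B * Real.exp ((p + 1) * x)) := by gcongr; exact hgB x
      _ = B * (‖kernel r l (x - w)‖ * Real.exp ((p + 1) * x)) := by ring
      _ ≤ B * _ := mul_le_mul_of_nonneg_left (norm_kernel_mul_exp_le hr hs hw p x) hB
      _ = _ := by ring
  have hint : Integrable fun x : ℝ => plateau (l p) (l (p + 1)) (x - w.re) :=
    (integrable_plateau _ _).comp_sub_right w.re
  refine ⟨(hint.const_mul _).mono' ?_ (Eventually.of_forall hbd), ?_⟩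
  · exact (continuous_kernel_sub hr hs hw).aestronglyMeasurable.mul hg
  · refine (norm_integral_le_of_norm_le (hint.const_mul _) (Eventually.of_forall hbd)).trans ?_
    rw [integral_const_mul, integral_sub_right_eq_self (fun x => plateau (l p) (l (p + 1)) x),
      integral_plateau (monotone_of_growth hr hκ hl (Nat.le_succ p))]

/-- The moments of the kernel. -/
def moment (r : ℝ) (l : ℕ → ℝ) (n : ℕ) : ℝ := ∫ x : ℝ, realKernel r l x * Real.exp (n * x)

lemma norm_cexp_natCast_mul (n : ℕ) (x : ℝ) :
    ‖Complex.exp ((n : ℂ) * x)‖ = Real.exp (n * x) := by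
  rw [Complex.norm_exp]
  simp

lemma integrable_kernel_mul_exp {r κ : ℝ} (hr : 0 < r) (hκ : 1 < κ) {l : ℕ → ℝ}
    (hl : ∀ p q : ℕ, p ≤ q → Real.exp ((l p - l q) / r) ≤ (((p : ℝ) + 1) / (q + 1)) ^ κ)
    {w : ℂ} (hw : w ∈ sector r) (p : ℕ) :
    Integrable fun x : ℝ => kernel r l (x - w) * Complex.exp (((p + 1 : ℕ) : ℂ) * x) := by
  refine (integral_kernel_mul_le hr hκ hl hw p (B := 1)
    (Continuous.aestronglyMeasurable (by fun_prop)) fun x => ?_).1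
  rw [norm_cexp_natCast_mul]
  push_cast
  rw [one_mul]

lemma zero_mem_sector {r : ℝ} (hr : 0 < r) : (0 : ℂ) ∈ sector r := by
  simpa using ofReal_mem_sector hr 0

lemma integrable_realKernel_mul_exp {r κ : ℝ} (hr : 0 < r) (hκ : 1 < κ) {l : ℕ → ℝ}
    (hl : ∀ p q : ℕ, p ≤ q → Real.exp ((l p - l q) / r) ≤ (((p : ℝ) + 1) / (q + 1)) ^ κ) (p : ℕ) :
    Integrable fun x : ℝ => realKernel r l x * Real.exp ((p + 1 : ℕ) * x) := by
  have h := (integrable_kernel_mul_exp hr hκ hl (zero_mem_sector hr) p).re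
  refine h.congr (Eventually.of_forall fun x => ?_)
  have : kernel r l (x - 0) * Complex.exp (((p + 1 : ℕ) : ℂ) * x) =
      ((realKernel r l x * Real.exp ((p + 1 : ℕ) * x) : ℝ) : ℂ) := by
    rw [sub_zero, kernel_ofReal]
    push_cast
    rfl
  simp only [this]
  exact Complex.ofReal_re _

/-- Integrate only over the unit interval ending at `l p`: the kernel is at least its value at `l
p`, and replacing `x` by `l p - 1` in the exponential accounts for the summand 1 in the constant. -/
lemma le_moment {r κ : ℝ} (hr : 0 < r) (hκ : 1 < κ) {l : ℕ → ℝ}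
    (hl : ∀ p q : ℕ, p ≤ q → Real.exp ((l p - l q) / r) ≤ (((p : ℝ) + 1) / (q + 1)) ^ κ) (p : ℕ) :
    Real.exp (∑ k ∈ Finset.range (p + 1), l k) ≤
      Real.exp (1 + (r * Real.log 2 + r / (κ - 1))) ^ (p + 1) * moment r l (p + 1) := by
  have hs := summable_exp_neg hκ hl
  have hint := integrable_realKernel_mul_exp hr hκ hl p
  have hpos : ∀ x, 0 ≤ realKernel r l x * Real.exp ((p + 1 : ℕ) * x) := fun x =>
    mul_nonneg (Real.exp_pos _).le (Real.exp_pos _).le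
  have h1 : ∫ x in Set.Ioc (l p - 1) (l p), realKernel r l (l p) *
      Real.exp ((p + 1 : ℕ) * (l p - 1)) ≤ moment r l (p + 1) := by
    refine le_trans ?_ (setIntegral_le_integral (s := Set.Ioc (l p - 1) (l p)) hint
      (Eventually.of_forall hpos))
    refine setIntegral_mono_on (integrableOn_const (by simp)) hint.integrableOn measurableSet_Ioc
      fun x hx => ?_
    refine mul_le_mul (antitone_realKernel hr hs hx.2) ?_ (Real.exp_pos _).le (Real.exp_pos _).le
    have := hx.1
    gcongr
  rw [setIntegral_const, measureReal_def, Real.volume_Ioc] at h1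
  simp only [sub_sub_cancel, ENNReal.ofReal_one, ENNReal.toReal_one, one_smul] at h1
  have h2 := le_realKernel hr hκ hl p
  calc Real.exp (∑ k ∈ Finset.range (p + 1), l k)
      = Real.exp (1 + (r * Real.log 2 + r / (κ - 1))) ^ (p + 1) *
        (Real.exp (∑ k ∈ Finset.range (p + 1), l k - (p + 1) * l p
          - (p + 1) * (r * Real.log 2 + r / (κ - 1))) * Real.exp ((p + 1 : ℕ) * (l p - 1))) := by
        rw [← Real.exp_nat_mul, ← Real.exp_add, ← Real.exp_add]
        congr 1
        push_cast
        ring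
    _ ≤ _ := by gcongr; exact le_trans (by gcongr) h1

lemma moment_pos {r κ : ℝ} (hr : 0 < r) (hκ : 1 < κ) {l : ℕ → ℝ}
    (hl : ∀ p q : ℕ, p ≤ q → Real.exp ((l p - l q) / r) ≤ (((p : ℝ) + 1) / (q + 1)) ^ κ) (p : ℕ) :
    0 < moment r l (p + 1) :=
  pos_of_mul_pos_right ((Real.exp_pos _).trans_le (le_moment hr hκ hl p)) (by positivity)

/-- Here the dominating function does not move with `w`, as differentiation under the integral
requires; the size of its constant is irrelevant. -/
lemma norm_kernel_mul_exp_le_of_abs_re_le {r : ℝ} (hr : 0 < r) {l : ℕ → ℝ}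
    (hl : Summable fun k => Real.exp (-l k / r)) {w : ℂ} (hw : w ∈ sector r) {X : ℝ}
    (hX : |w.re| ≤ X) (p : ℕ) (x : ℝ) :
    ‖kernel r l (x - w)‖ * Real.exp ((p + 1) * x) ≤
      Real.exp (|∑ k ∈ Finset.range p, l k| + |∑ k ∈ Finset.range (p + 2), l k| + (p + 2) * X) *
        plateau 0 0 x := by
  have hk := norm_kernel_le hr hl (ofReal_sub_mem_sector hw x)
  have hX' := abs_le.1 hX
  have key : ∀ j : ℕ, ∀ t : ℝ, ∑ k ∈ Finset.range j, l k - j * (x - w.re) + (p + 1) * x ≤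
      |∑ k ∈ Finset.range p, l k| + |∑ k ∈ Finset.range (p + 2), l k| + (p + 2) * X + t →
      Real.exp t ≤ plateau 0 0 x →
      ‖kernel r l (x - w)‖ * Real.exp ((p + 1) * x) ≤
      Real.exp (|∑ k ∈ Finset.range p, l k| + |∑ k ∈ Finset.range (p + 2), l k| + (p + 2) * X) *
        plateau 0 0 x := by
    intro j t h1 h2
    have h3 := hk j
    rw [Complex.sub_re, Complex.ofReal_re] at h3
    calc _ ≤ Real.exp (∑ k ∈ Finset.range j, l k - j * (x - w.re)) * Real.exp ((p + 1) * x) := by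
          gcongr
      _ ≤ Real.exp (|∑ k ∈ Finset.range p, l k| + |∑ k ∈ Finset.range (p + 2), l k| +
            (p + 2) * X) * Real.exp t := by
          rw [← Real.exp_add, ← Real.exp_add]
          exact Real.exp_le_exp.2 h1
      _ ≤ _ := by gcongr
  have a1 := abs_nonneg (∑ k ∈ Finset.range p, l k)
  have a2 := abs_nonneg (∑ k ∈ Finset.range (p + 2), l k)
  have a3 := le_abs_self (∑ k ∈ Finset.range p, l k)
  have a4 := le_abs_self (∑ k ∈ Finset.range (p + 2), l k)
  have hX0 : 0 ≤ X := (abs_nonneg _).trans hX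
  have h1 : (p : ℝ) * w.re ≤ p * X := by gcongr; exact hX'.2
  have h2 : ((p : ℝ) + 2) * w.re ≤ (p + 2) * X := by gcongr; exact hX'.2
  rcases le_or_gt x 0 with h | h
  · refine key p _ ?_ (exp_le_plateau h)
    have : (p : ℝ) * (x - w.re) = p * x - p * w.re := by ring
    linarith
  · refine key (p + 2) _ ?_ (exp_le_plateau' h)
    push_cast
    have : ((p : ℝ) + 2) * (x - w.re) = (p + 2) * x - (p + 2) * w.re := by ring
    linarith

lemma isPreconnected_sector (r : ℝ) : IsPreconnected (sector r) := by
  have : sector r = {w : ℂ | -(r * Real.pi / 2) < w.im} ∩ {w : ℂ | w.im < r * Real.pi / 2} := by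
    ext w
    rw [mem_sector, abs_lt]
    rfl
  rw [this]
  exact ((convex_halfSpace_im_gt _).inter (convex_halfSpace_im_lt _)).isPreconnected

/-- For real `w` this is a translation of the integration variable. Both sides are holomorphic on
the connected sector, so the identity theorem extends it. -/
lemma integral_kernel_mul_exp {r κ : ℝ} (hr : 0 < r) (hκ : 1 < κ) {l : ℕ → ℝ}
    (hl : ∀ p q : ℕ, p ≤ q → Real.exp ((l p - l q) / r) ≤ (((p : ℝ) + 1) / (q + 1)) ^ κ)
    {w : ℂ} (hw : w ∈ sector r) (p : ℕ) :
    ∫ x : ℝ, kernel r l (x - w) * Complex.exp (((p + 1 : ℕ) : ℂ) * x) =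
      moment r l (p + 1) * Complex.exp w ^ (p + 1) := by
  have hs := summable_exp_neg hκ hl
  have hJ : DifferentiableOn ℂ (fun w => ∫ x : ℝ, kernel r l (x - w) *
      Complex.exp (((p + 1 : ℕ) : ℂ) * x)) (sector r) := by
    intro w₀ hw₀
    have hU : IsOpen (sector r ∩ {w : ℂ | |w.re| < |w₀.re| + 1}) :=
      (isOpen_sector r).inter (isOpen_lt (continuous_abs.comp Complex.continuous_re)
        continuous_const)
    have hd := differentiableOn_integral_comp_sub (differentiableOn_kernel hr hs)
      (g := fun x : ℝ => Complex.exp (((p + 1 : ℕ) : ℂ) * x))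
      (Continuous.aestronglyMeasurable (by fun_prop)) hU Set.inter_subset_left
      ((integrable_plateau 0 0).const_mul _) (fun w hw x => by
        rw [norm_mul, norm_cexp_natCast_mul]
        have := norm_kernel_mul_exp_le_of_abs_re_le hr hs hw.1 (le_of_lt hw.2) p x
        push_cast
        exact this)
    exact (hd.differentiableAt (hU.mem_nhds ⟨hw₀, by simp⟩)).differentiableWithinAt
  have hreal : ∀ t : ℝ, ∫ x : ℝ, kernel r l (x - t) * Complex.exp (((p + 1 : ℕ) : ℂ) * x) =
      moment r l (p + 1) * Complex.exp t ^ (p + 1) := by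
    intro t
    have e : ∀ x : ℝ, kernel r l (x - t) * Complex.exp (((p + 1 : ℕ) : ℂ) * x) =
        ((realKernel r l (x - t) * Real.exp ((p + 1 : ℕ) * (x - t)) : ℝ) : ℂ) *
          Complex.exp t ^ (p + 1) := by
      intro x
      rw [← Complex.ofReal_sub, kernel_ofReal, ← Complex.exp_nat_mul, Complex.ofReal_mul, mul_assoc,
        Complex.ofReal_exp, ← Complex.exp_add]
      congr 2
      push_cast
      ring
    simp only [e]
    rw [integral_mul_const, integral_complex_ofReal,
      integral_sub_right_eq_self (fun x => realKernel r l x * Real.exp ((p + 1 : ℕ) * x)), moment]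
  have hR : DifferentiableOn ℂ (fun w => (moment r l (p + 1) : ℂ) * Complex.exp w ^ (p + 1))
      (sector r) := by fun_prop
  refine (hJ.analyticOnNhd (isOpen_sector r)).eqOn_of_preconnected_of_frequently_eq
    (hR.analyticOnNhd (isOpen_sector r)) (isPreconnected_sector r) (zero_mem_sector hr) ?_ hw
  have ht : Tendsto (fun n : ℕ => ((1 / ((n : ℝ) + 1) : ℝ) : ℂ)) atTop (𝓝[≠] 0) := by
    refine tendsto_nhdsWithin_iff.2 ⟨?_, Eventually.of_forall fun n => ?_⟩
    · have := (Complex.continuous_ofReal.tendsto 0).comp tendsto_one_div_add_atTop_nhds_zero_nat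
      rw [Complex.ofReal_zero] at this
      exact this
    · have : (1 / ((n : ℝ) + 1)) ≠ 0 := by positivity
      exact Complex.ofReal_ne_zero.2 this
  exact ht.frequently (Frequently.of_forall fun n => hreal _)

/-! ### Truncated Laplace transforms -/

/-- The sum of `b n * exp ((n + 1) x)`, cut off above `ρ`. -/
def truncatedSum (b : ℕ → ℂ) (ρ : ℝ) : ℝ → ℂ :=
  (Set.Iic ρ).indicator fun x => ∑' n : ℕ, b n * Complex.exp (((n + 1 : ℕ) : ℂ) * x)

lemma norm_term_le {b : ℕ → ℂ} {B C : ℝ} (hb : ∀ n, ‖b n‖ ≤ C * B ^ (n + 1)) (n : ℕ) (x : ℝ) :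
    ‖b n * Complex.exp (((n + 1 : ℕ) : ℂ) * x)‖ ≤ C * (B * Real.exp x) ^ (n + 1) := by
  rw [norm_mul, norm_cexp_natCast_mul, mul_pow, ← Real.exp_nat_mul, ← mul_assoc]
  gcongr
  exact hb n

lemma aestronglyMeasurable_truncatedSum {b : ℕ → ℂ} {B C ρ : ℝ} (hB : 0 < B) (hC : 0 ≤ C)
    (hb : ∀ n, ‖b n‖ ≤ C * B ^ (n + 1)) (hρ : B * Real.exp ρ = 1 / 2) :
    AEStronglyMeasurable (truncatedSum b ρ) := by
  refine (aestronglyMeasurable_indicator_iff measurableSet_Iic).2 ?_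
  refine ContinuousOn.aestronglyMeasurable ?_ measurableSet_Iic
  refine continuousOn_tsum (u := fun n => C * (1 / 2 : ℝ) ^ (n + 1)) (fun n => by fun_prop) ?_
    fun n x hx => (norm_term_le hb n x).trans ?_
  · exact ((summable_nat_add_iff 1).2 summable_geometric_two).mul_left C
  · rw [← hρ]
    have : x ≤ ρ := hx
    gcongr

/-- Below `ρ` the difference is the tail of a geometric series. Above `ρ` only the partial sum
remains, and `2 y ≥ 1` allows every lower power to be raised to `p + 1`. The bound thus holds on the
whole line. -/
lemma norm_truncatedSum_sub_le {b : ℕ → ℂ} {B C ρ : ℝ} (hB : 0 < B) (hC : 0 ≤ C)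
    (hb : ∀ n, ‖b n‖ ≤ C * B ^ (n + 1)) (hρ : B * Real.exp ρ = 1 / 2) (p : ℕ) (x : ℝ) :
    ‖truncatedSum b ρ x - ∑ n ∈ Finset.range p, b n * Complex.exp (((n + 1 : ℕ) : ℂ) * x)‖ ≤
      2 * C * (2 * B) ^ (p + 1) * Real.exp ((p + 1) * x) := by
  have e1 : Real.exp ((p + 1) * x) = Real.exp x ^ (p + 1) := by
    rw [← Real.exp_nat_mul]
    push_cast
    rfl
  have e2 : 2 * C * (2 * B) ^ (p + 1) * Real.exp ((p + 1) * x) =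
      2 * C * (2 * (B * Real.exp x)) ^ (p + 1) := by
    rw [e1, mul_assoc (2 * C), ← mul_pow, mul_assoc 2 B]
  rw [e2]
  set y := B * Real.exp x with hy
  have hy0 : 0 < y := by positivity
  rcases le_or_gt x ρ with hx | hx
  · have hy2 : y ≤ 1 / 2 := by
      rw [← hρ, hy]
      gcongr
    have hgeo : Summable fun n : ℕ => C * y ^ (n + 1) :=
      ((summable_nat_add_iff 1).2 (summable_geometric_of_lt_one hy0.le (by linarith))).mul_left C
    have hsum : Summable fun n : ℕ => b n * Complex.exp (((n + 1 : ℕ) : ℂ) * x) :=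
      Summable.of_norm_bounded hgeo fun n => norm_term_le hb n x
    rw [truncatedSum, Set.indicator_of_mem (Set.mem_Iic.2 hx), ← hsum.sum_add_tsum_nat_add p,
      add_sub_cancel_left]
    have hg : HasSum (fun j : ℕ => C * y ^ (p + 1) * y ^ j) (C * y ^ (p + 1) * (1 - y)⁻¹) :=
      (hasSum_geometric_of_lt_one hy0.le (by linarith)).mul_left _
    refine (tsum_of_norm_bounded hg fun j =>
      (norm_term_le hb (j + p) x).trans (le_of_eq ?_)).trans ?_
    · rw [← hy]
      ring
    · have h1 : (1 - y)⁻¹ ≤ 2 := by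
        rw [inv_le_comm₀ (by linarith) two_pos]
        linarith
      have h2 : y ^ (p + 1) ≤ (2 * y) ^ (p + 1) := by
        gcongr
        linarith
      calc C * y ^ (p + 1) * (1 - y)⁻¹ ≤ C * (2 * y) ^ (p + 1) * 2 := by
            gcongr
            exact inv_nonneg.2 (by linarith)
        _ = _ := by ring
  · have hy2 : 1 ≤ 2 * y := by
      have : B * Real.exp ρ < y := by
        rw [hy]
        gcongr
      linarith
    rw [truncatedSum, Set.indicator_of_notMem (by simpa using hx), zero_sub, norm_neg]
    have h1 : ∀ n ∈ Finset.range p, ‖b n * Complex.exp (((n + 1 : ℕ) : ℂ) * x)‖ ≤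
        C * (2 * y) ^ (p + 1) * (1 / 2) ^ n := by
      intro n hn
      refine (norm_term_le hb n x).trans ?_
      have h3 : (2 * y) ^ (n + 1) ≤ (2 * y) ^ (p + 1) :=
        pow_le_pow_right₀ hy2 (by have := Finset.mem_range.1 hn; omega)
      have h4 : (1 / 2 : ℝ) ^ (n + 1) ≤ (1 / 2) ^ n :=
        pow_le_pow_of_le_one (by norm_num) (by norm_num) (Nat.le_succ n)
      calc C * (B * Real.exp x) ^ (n + 1) = C * ((2 * y) ^ (n + 1) * (1 / 2) ^ (n + 1)) := by
            rw [← mul_pow, ← hy]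
            ring_nf
        _ ≤ C * ((2 * y) ^ (p + 1) * (1 / 2) ^ n) := by gcongr
        _ = _ := by ring
    refine (norm_sum_le_of_le _ h1).trans ?_
    rw [← Finset.mul_sum]
    calc C * (2 * y) ^ (p + 1) * ∑ n ∈ Finset.range p, (1 / 2 : ℝ) ^ n
        ≤ C * (2 * y) ^ (p + 1) * 2 := by
          gcongr
          exact sum_geometric_two_le p
      _ = _ := by ring

/-- Functions with prescribed asymptotic expansion: if the logarithms `l` of the quotients of a
sequence grow fast enough, and do not jump too much, then every formal power series with
coefficients bounded by the sequence is the expansion of a function on the sector. -/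
theorem exists_expansion_of_growth {r κ : ℝ} (hr : 0 < r) (hκ : 1 < κ) {l : ℕ → ℝ}
    (hl : ∀ p q : ℕ, p ≤ q → Real.exp ((l p - l q) / r) ≤ (((p : ℝ) + 1) / (q + 1)) ^ κ)
    {C₀ H : ℝ} (hC₀ : 0 ≤ C₀) (hH : 1 ≤ H) (hsm : ∀ p, l (p + 1) - l p ≤ C₀ * H ^ (p + 1))
    {a : ℕ → ℂ} {C : ℝ} (ha : ∀ n, ‖a n‖ ≤ C * Real.exp (∑ k ∈ Finset.range n, l k)) :
    ∃ f : ℂ → ℂ, DifferentiableOn ℂ f (sector r) ∧ ∃ D A : ℝ, 0 < D ∧ 0 < A ∧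
      ∀ p : ℕ, ∀ w ∈ sector r, ‖f w - ∑ n ∈ Finset.range p, a n * Complex.exp w ^ n‖ ≤
        D * A ^ p * Real.exp (∑ k ∈ Finset.range p, l k) * Real.exp w.re ^ p := by
  have hs := summable_exp_neg hκ hl
  have hC : 0 ≤ C := nonneg_of_mul_nonneg_left ((norm_nonneg _).trans (ha 0)) (Real.exp_pos _)
  set B : ℝ := Real.exp (1 + (r * Real.log 2 + r / (κ - 1))) with hBdef
  have hB : 0 < B := Real.exp_pos _
  -- The kernel tends to 1 at `-∞`, so it has no finite moment of order 0; `a 0` is added outside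
  -- the integral.
  set b : ℕ → ℂ := fun n => a (n + 1) / moment r l (n + 1) with hbdef
  have hb : ∀ n, ‖b n‖ ≤ C * B ^ (n + 1) := by
    intro n
    have hm := moment_pos hr hκ hl n
    rw [hbdef, norm_div, Complex.norm_real, Real.norm_of_nonneg hm.le, div_le_iff₀ hm, mul_assoc]
    exact (ha (n + 1)).trans (mul_le_mul_of_nonneg_left (le_moment hr hκ hl n) hC)
  -- The cut is at half the radius of convergence guaranteed by `hb`.
  set ρ : ℝ := Real.log (1 / (2 * B)) with hρdef
  have hρ : B * Real.exp ρ = 1 / 2 := by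
    rw [hρdef, Real.exp_log (by positivity)]
    field_simp
  have hGm := aestronglyMeasurable_truncatedSum hB hC hb hρ
  set b₀ : ℝ → ℝ := (Set.Iic ρ).indicator fun x => 2 * C * (2 * B) * Real.exp x with hb₀
  have hb₀i : Integrable b₀ :=
    (integrable_indicator_iff measurableSet_Iic).2 ((integrableOn_exp_Iic ρ).const_mul _)
  have hGb : ∀ x, ‖truncatedSum b ρ x‖ ≤ b₀ x := by
    intro x
    by_cases hx : x ∈ Set.Iic ρ
    · have := norm_truncatedSum_sub_le hB hC hb hρ 0 x
      rw [hb₀, Set.indicator_of_mem hx]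
      simpa using this
    · rw [hb₀, truncatedSum, Set.indicator_of_notMem hx, Set.indicator_of_notMem hx, norm_zero]
  have hkG : ∀ w ∈ sector r, ∀ x : ℝ, ‖kernel r l (x - w) * truncatedSum b ρ x‖ ≤ b₀ x := by
    intro w hw x
    have h1 := norm_kernel_le hr hs (ofReal_sub_mem_sector hw x) 0
    simp only [Finset.range_zero, Finset.sum_empty, Nat.cast_zero, zero_mul, sub_zero,
      Real.exp_zero] at h1
    rw [norm_mul]
    exact (mul_le_of_le_one_left (norm_nonneg _) h1).trans (hGb x)
  have hK : 0 ≤ ∫ x, b₀ x := integral_nonneg fun x => (norm_nonneg _).trans (hGb x)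
  -- In the constant, `2 * C * (2 + C₀)` serves the orders `p ≥ 1`, the parenthesis serves `p = 0`,
  -- and the final 1 ensures positivity.
  refine ⟨fun w => a 0 + ∫ x : ℝ, kernel r l (x - w) * truncatedSum b ρ x,
    (differentiableOn_integral_comp_sub (differentiableOn_kernel hr hs) hGm (isOpen_sector r)
      subset_rfl hb₀i hkG).const_add _, 2 * C * (2 + C₀) + (‖a 0‖ + ∫ x, b₀ x) + 1, 2 * B * H,
    by positivity, by positivity, fun p w hw => ?_⟩
  have hD : 0 ≤ 2 * C * (2 + C₀) := by positivity
  cases p with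
  | zero =>
    simp only [Finset.range_zero, Finset.sum_empty, sub_zero, pow_zero, mul_one, Real.exp_zero]
    refine (norm_add_le _ _).trans ?_
    have := norm_integral_le_of_norm_le hb₀i (Eventually.of_forall (hkG w hw))
    linarith
  | succ p =>
    have hi : ∀ n ∈ Finset.range p, Integrable fun x : ℝ =>
        kernel r l (x - w) * (b n * Complex.exp (((n + 1 : ℕ) : ℂ) * x)) := by
      intro n _
      refine ((integrable_kernel_mul_exp hr hκ hl hw n).const_mul (b n)).congr
        (Eventually.of_forall fun x => ?_)
      simp only
      ring
    have hiG : Integrable fun x : ℝ => kernel r l (x - w) * truncatedSum b ρ x :=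
      hb₀i.mono' ((continuous_kernel_sub hr hs hw).aestronglyMeasurable.mul hGm)
        (Eventually.of_forall (hkG w hw))
    have hQ : ∫ x : ℝ, kernel r l (x - w) *
        ∑ n ∈ Finset.range p, b n * Complex.exp (((n + 1 : ℕ) : ℂ) * x) =
        ∑ n ∈ Finset.range p, a (n + 1) * Complex.exp w ^ (n + 1) := by
      simp only [Finset.mul_sum]
      rw [integral_finsetSum _ hi]
      refine Finset.sum_congr rfl fun n _ => ?_
      have e : ∀ x : ℝ, kernel r l (x - w) * (b n * Complex.exp (((n + 1 : ℕ) : ℂ) * x)) =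
          b n * (kernel r l (x - w) * Complex.exp (((n + 1 : ℕ) : ℂ) * x)) := fun x => by ring
      simp only [e]
      rw [integral_const_mul, integral_kernel_mul_exp hr hκ hl hw, ← mul_assoc, hbdef]
      have hm : (moment r l (n + 1) : ℂ) ≠ 0 :=
        Complex.ofReal_ne_zero.2 (moment_pos hr hκ hl n).ne'
      simp only
      rw [div_mul_cancel₀ _ hm]
    have hrem : a 0 + (∫ x : ℝ, kernel r l (x - w) * truncatedSum b ρ x) -
        ∑ n ∈ Finset.range (p + 1), a n * Complex.exp w ^ n =
        ∫ x : ℝ, kernel r l (x - w) * (truncatedSum b ρ x -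
          ∑ n ∈ Finset.range p, b n * Complex.exp (((n + 1 : ℕ) : ℂ) * x)) := by
      rw [Finset.sum_range_succ', ← hQ]
      simp only [mul_sub]
      rw [integral_sub hiG]
      · ring
      · simp only [Finset.mul_sum]
        exact integrable_finsetSum _ hi
    rw [hrem]
    refine (integral_kernel_mul_le hr hκ hl hw p (hGm.sub
      (Continuous.aestronglyMeasurable (by fun_prop)))
      (norm_truncatedSum_sub_le hB hC hb hρ p)).2.trans ?_
    -- Here (sm) enters: the jump of `l` costs only a geometric factor.
    have h1 : 2 + (l (p + 1) - l p) ≤ (2 + C₀) * H ^ (p + 1) := by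
      have := hsm p
      have h2 : 1 ≤ H ^ (p + 1) := one_le_pow₀ hH
      nlinarith
    calc _ ≤ 2 * C * (2 * B) ^ (p + 1) *
          Real.exp (∑ k ∈ Finset.range (p + 1), l k + (p + 1) * w.re) *
          ((2 + C₀) * H ^ (p + 1)) := by gcongr
      _ = (2 * C * (2 + C₀)) * (2 * B * H) ^ (p + 1) *
          Real.exp (∑ k ∈ Finset.range (p + 1), l k) * Real.exp w.re ^ (p + 1) := by
          rw [Real.exp_add, ← Real.exp_nat_mul, mul_pow (2 * B)]
          push_cast
          ring
      _ ≤ _ := by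
          gcongr
          linarith [norm_nonneg (a 0)]

/-! ### Regularization of sequences -/

/-- The largest minorant `μ` of `m` for which `μ p / (p + 1) ^ γ` is increasing. -/
def regularized (m : ℕ → ℝ) (γ : ℝ) (p : ℕ) : ℝ :=
  ((p : ℝ) + 1) ^ γ * ⨅ k : ℕ, m (p + k) / (((p + k : ℕ) : ℝ) + 1) ^ γ

lemma bddBelow_range_of_pos {c : ℕ → ℝ} (hc : ∀ p, 0 < c p) : BddBelow (Set.range c) :=
  ⟨0, by rintro _ ⟨p, rfl⟩; exact (hc p).le⟩

lemma regularized_le {m : ℕ → ℝ} (hm : ∀ p, 0 < m p) (γ : ℝ) (p : ℕ) :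
    regularized m γ p ≤ m p := by
  have h := ciInf_le (bddBelow_range_of_pos (c := fun k : ℕ =>
    m (p + k) / (((p + k : ℕ) : ℝ) + 1) ^ γ) fun k => div_pos (hm _) (by positivity)) 0
  rw [add_zero, le_div_iff₀ (by positivity)] at h
  rw [regularized, mul_comm]
  exact h

lemma le_mul_regularized {m : ℕ → ℝ} {γ a : ℝ} (ha : 0 < a)
    (h : ∀ p q : ℕ, p ≤ q → m p / ((p : ℝ) + 1) ^ γ ≤ a * (m q / ((q : ℝ) + 1) ^ γ)) (p : ℕ) :
    m p ≤ a * regularized m γ p := by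
  have h1 : m p / ((p : ℝ) + 1) ^ γ / a ≤ ⨅ k : ℕ, m (p + k) / (((p + k : ℕ) : ℝ) + 1) ^ γ := by
    refine le_ciInf fun k => ?_
    rw [div_le_iff₀' ha]
    exact h p (p + k) (Nat.le_add_right p k)
  rw [div_le_iff₀' ha, div_le_iff₀' (by positivity)] at h1
  rw [regularized]
  linarith

lemma regularized_div_le {m : ℕ → ℝ} (hm : ∀ p, 0 < m p) (γ : ℝ) {p q : ℕ} (hpq : p ≤ q) :
    regularized m γ p / ((p : ℝ) + 1) ^ γ ≤ regularized m γ q / ((q : ℝ) + 1) ^ γ := by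
  rw [regularized, regularized, mul_div_cancel_left₀ _ (by positivity),
    mul_div_cancel_left₀ _ (by positivity)]
  refine le_ciInf fun k => ?_
  obtain ⟨j, rfl⟩ := Nat.exists_eq_add_of_le hpq
  rw [add_assoc]
  exact ciInf_le (bddBelow_range_of_pos (c := fun k : ℕ =>
    m (p + k) / (((p + k : ℕ) : ℝ) + 1) ^ γ) fun k => div_pos (hm _) (by positivity)) (j + k)

/-! ### Null sequences of slow decay -/

lemma exists_antitone_majorant {v : ℕ → ℝ} (hv : Tendsto v atTop (𝓝 0)) (hpos : ∀ p, 0 < v p) :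
    ∃ σ : ℕ → ℝ, Antitone σ ∧ Tendsto σ atTop (𝓝 0) ∧ ∀ p, v p ≤ σ p := by
  have hbdd : ∀ p, BddAbove (Set.range fun k => v (p + k)) := fun p => by
    obtain ⟨K, hK⟩ := hv.bddAbove_range
    exact ⟨K, by rintro _ ⟨k, rfl⟩; exact hK ⟨_, rfl⟩⟩
  have hle : ∀ p, v p ≤ ⨆ k, v (p + k) := fun p => le_ciSup (hbdd p) 0
  refine ⟨fun p => ⨆ k, v (p + k), fun p q hpq => ciSup_le fun k => ?_, ?_, hle⟩
  · obtain ⟨j, rfl⟩ := Nat.exists_eq_add_of_le hpq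
    rw [add_assoc]
    exact le_ciSup (hbdd p) (j + k)
  · rw [Metric.tendsto_atTop] at hv ⊢
    intro ε hε
    obtain ⟨N, hN⟩ := hv (ε / 2) (by positivity)
    refine ⟨N, fun n hn => ?_⟩
    rw [Real.dist_eq, sub_zero, abs_of_pos ((hpos n).trans_le (hle n))]
    refine lt_of_le_of_lt (ciSup_le fun k => ?_) (half_lt_self hε)
    have := hN (n + k) (by omega)
    rw [Real.dist_eq, sub_zero] at this
    exact (le_abs_self _).trans this.le

/-- The smallest majorant `θ` of `σ` with `θ p * (p + 1) ^ δ` increasing. -/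
def slowed (σ : ℕ → ℝ) (δ : ℝ) : ℕ → ℝ
  | 0 => σ 0
  | p + 1 => max (slowed σ δ p * (((p : ℝ) + 1) / (p + 2)) ^ δ) (σ (p + 1))

lemma le_slowed (σ : ℕ → ℝ) (δ : ℝ) : ∀ p, σ p ≤ slowed σ δ p
  | 0 => le_rfl
  | _ + 1 => le_max_right _ _

lemma monotone_slowed_mul {σ : ℕ → ℝ} (δ : ℝ) :
    Monotone fun p : ℕ => slowed σ δ p * ((p : ℝ) + 1) ^ δ := by
  refine monotone_nat_of_le_succ fun p => ?_
  have h : slowed σ δ p * (((p : ℝ) + 1) / (p + 2)) ^ δ ≤ slowed σ δ (p + 1) := le_max_left _ _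
  rw [Real.div_rpow (by positivity) (by positivity), mul_div_assoc',
    div_le_iff₀ (by positivity)] at h
  have e : (((p + 1 : ℕ) : ℝ) + 1) = p + 2 := by push_cast; ring
  rw [e]
  exact h

lemma antitone_slowed {σ : ℕ → ℝ} (hσ : Antitone σ) (h0 : ∀ p, 0 < σ p) {δ : ℝ} (hδ : 0 < δ) :
    Antitone (slowed σ δ) := by
  refine antitone_nat_of_succ_le fun p => max_le ?_ ((hσ (Nat.le_succ p)).trans (le_slowed σ δ p))
  refine mul_le_of_le_one_right ((h0 p).le.trans (le_slowed σ δ p)) ?_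
  exact Real.rpow_le_one (by positivity) (div_le_one_of_le₀ (by linarith) (by positivity)) hδ.le

/-- Once `σ < ε`, each new value either comes from `σ` or keeps the product with `(p + 1)^δ`
unchanged. So a value is either below `ε` or at most `K / (p + 1)^δ`, which tends to 0. -/
lemma tendsto_slowed {σ : ℕ → ℝ} (hσ : Tendsto σ atTop (𝓝 0)) (h0 : ∀ p, 0 < σ p) {δ : ℝ}
    (hδ : 0 < δ) : Tendsto (slowed σ δ) atTop (𝓝 0) := by
  have hpos : ∀ p, 0 < slowed σ δ p := fun p => (h0 p).trans_le (le_slowed σ δ p)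
  rw [Metric.tendsto_atTop]
  intro ε hε
  obtain ⟨Q, hQ⟩ := Metric.tendsto_atTop.1 hσ ε hε
  have hQ' : ∀ p, Q ≤ p → σ p < ε := fun p hp => by
    have := hQ p hp
    rwa [Real.dist_eq, sub_zero, abs_of_pos (h0 p)] at this
  set K := slowed σ δ Q * ((Q : ℝ) + 1) ^ δ with hK
  have hbound : ∀ j, slowed σ δ (Q + j) < ε ∨
      slowed σ δ (Q + j) * (((Q + j : ℕ) : ℝ) + 1) ^ δ ≤ K := by
    intro j
    induction j with
    | zero => right; exact le_rfl
    | succ j ih =>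
      have hle : slowed σ δ (Q + j) * ((((Q + j : ℕ) : ℝ) + 1) / ((Q + j : ℕ) + 2)) ^ δ ≤
          slowed σ δ (Q + j) := by
        refine mul_le_of_le_one_right (hpos _).le ?_
        exact Real.rpow_le_one (by positivity)
          (div_le_one_of_le₀ (by linarith) (by positivity)) hδ.le
      rcases max_cases (slowed σ δ (Q + j) * ((((Q + j : ℕ) : ℝ) + 1) / ((Q + j : ℕ) + 2)) ^ δ)
        (σ (Q + j + 1)) with ⟨h, -⟩ | ⟨h, -⟩
      · have h' : slowed σ δ (Q + (j + 1)) =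
            slowed σ δ (Q + j) * ((((Q + j : ℕ) : ℝ) + 1) / ((Q + j : ℕ) + 2)) ^ δ := h
        rcases ih with ih | ih
        · left
          rw [h']
          exact hle.trans_lt ih
        · right
          rw [h', Real.div_rpow (by positivity) (by positivity)]
          have e : (((Q + (j + 1) : ℕ) : ℝ) + 1) = ((Q + j : ℕ) : ℝ) + 2 := by push_cast; ring
          rw [e, mul_assoc, div_mul_cancel₀ _ (by positivity)]
          exact ih
      · left
        have h' : slowed σ δ (Q + (j + 1)) = σ (Q + j + 1) := h
        rw [h']
        exact hQ' _ (by omega)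
  have ht : Tendsto (fun p : ℕ => K / ((p : ℝ) + 1) ^ δ) atTop (𝓝 0) := by
    refine Tendsto.div_atTop tendsto_const_nhds ((tendsto_rpow_atTop hδ).comp ?_)
    exact tendsto_atTop_add_const_right _ _ tendsto_natCast_atTop_atTop
  obtain ⟨N, hN⟩ := Metric.tendsto_atTop.1 ht ε hε
  refine ⟨max N Q, fun n hn => ?_⟩
  rw [Real.dist_eq, sub_zero, abs_of_pos (hpos n)]
  obtain ⟨j, rfl⟩ := Nat.exists_eq_add_of_le ((le_max_right N Q).trans hn)
  rcases hbound j with h | h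
  · exact h
  · have h1 := hN _ ((le_max_left N Q).trans hn)
    rw [Real.dist_eq, sub_zero] at h1
    exact ((le_div_iff₀ (by positivity)).2 h).trans_lt ((le_abs_self _).trans_lt h1)

lemma tendsto_rpow_one_div {ε : ℕ → ℝ} (h0 : ∀ n, 0 ≤ ε n)
    (h : ∀ t : ℝ, 0 < t → ∃ C : ℝ, ∀ n, ε n ≤ C * t ^ n) :
    Tendsto (fun n => ε (n + 1) ^ (1 / ((n : ℝ) + 1))) atTop (𝓝 0) := by
  rw [Metric.tendsto_atTop]
  intro t ht
  -- One factor 2 absorbs `C` for large `n`, the other gives strict inequality.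
  obtain ⟨C, hC⟩ := h (t / 4) (by positivity)
  obtain ⟨N, hN⟩ := pow_unbounded_of_one_lt C (one_lt_two)
  refine ⟨N, fun n hn => ?_⟩
  rw [Real.dist_eq, sub_zero, abs_of_nonneg (Real.rpow_nonneg (h0 _) _)]
  have h1 : ε (n + 1) ≤ (t / 2) ^ (n + 1) := by
    refine (hC (n + 1)).trans ?_
    have h2 : C ≤ 2 ^ (n + 1) := hN.le.trans (pow_le_pow_right₀ one_le_two (by omega))
    calc C * (t / 4) ^ (n + 1) ≤ 2 ^ (n + 1) * (t / 4) ^ (n + 1) := by gcongr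
      _ = (t / 2) ^ (n + 1) := by rw [← mul_pow]; ring_nf
  calc ε (n + 1) ^ (1 / ((n : ℝ) + 1)) ≤ ((t / 2) ^ (n + 1)) ^ (1 / ((n : ℝ) + 1)) := by
        exact Real.rpow_le_rpow (h0 _) h1 (by positivity)
    _ = t / 2 := by
        have := Real.pow_rpow_inv_natCast (show 0 ≤ t / 2 by positivity) (Nat.succ_ne_zero n)
        rw [one_div]
        push_cast at this
        exact this
    _ < t := half_lt_self ht

/-- Take a decreasing majorant `σ` of the roots of `ε`: then `ε (n + 1) ≤ σ n ^ (n + 1) ≤ ∏ σ k`,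
and slowing `σ` down only enlarges the product. The term `1 / (n + 1)` added to the roots keeps
everything positive. -/
lemma exists_slow_factors {ε : ℕ → ℝ} (h0 : ∀ n, 0 ≤ ε n)
    (h : ∀ t : ℝ, 0 < t → ∃ C : ℝ, ∀ n, ε n ≤ C * t ^ n) {δ : ℝ} (hδ : 0 < δ) :
    ∃ θ : ℕ → ℝ, (∀ p, 0 < θ p) ∧ Antitone θ ∧ Tendsto θ atTop (𝓝 0) ∧
      (Monotone fun p : ℕ => θ p * ((p : ℝ) + 1) ^ δ) ∧
      ∀ n, ε (n + 1) ≤ ∏ k ∈ Finset.range (n + 1), θ k := by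
  have hv : Tendsto (fun n : ℕ => ε (n + 1) ^ (1 / ((n : ℝ) + 1)) + 1 / ((n : ℝ) + 1)) atTop
      (𝓝 0) := by
    simpa using (tendsto_rpow_one_div h0 h).add tendsto_one_div_add_atTop_nhds_zero_nat
  have hvpos : ∀ n : ℕ, 0 < ε (n + 1) ^ (1 / ((n : ℝ) + 1)) + 1 / ((n : ℝ) + 1) := fun n =>
    add_pos_of_nonneg_of_pos (Real.rpow_nonneg (h0 _) _) (by positivity)
  obtain ⟨σ, hσ, hσt, hσv⟩ := exists_antitone_majorant hv hvpos
  have hσ0 : ∀ p, 0 < σ p := fun p => (hvpos p).trans_le (hσv p)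
  refine ⟨slowed σ δ, fun p => (hσ0 p).trans_le (le_slowed σ δ p), antitone_slowed hσ hσ0 hδ,
    tendsto_slowed hσt hσ0 hδ, monotone_slowed_mul δ, fun n => ?_⟩
  have h1 : ε (n + 1) ^ (1 / ((n : ℝ) + 1)) ≤ σ n := by
    have := hσv n
    have h2 : 0 < 1 / ((n : ℝ) + 1) := by positivity
    linarith
  calc ε (n + 1) = (ε (n + 1) ^ (1 / ((n : ℝ) + 1))) ^ (n + 1) := by
        have := Real.rpow_inv_natCast_pow (h0 (n + 1)) (Nat.succ_ne_zero n)
        rw [one_div]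
        push_cast at this
        exact this.symm
    _ ≤ σ n ^ (n + 1) := by
        gcongr
        exact Real.rpow_nonneg (h0 _) _
    _ = ∏ _k ∈ Finset.range (n + 1), σ n := by rw [Finset.prod_const, Finset.card_range]
    _ ≤ ∏ k ∈ Finset.range (n + 1), slowed σ δ k := by
        refine Finset.prod_le_prod (fun k _ => (hσ0 n).le) fun k hk => ?_
        exact (hσ (Nat.lt_succ_iff.1 (Finset.mem_range.1 hk))).trans (le_slowed σ δ k)

/-- The products of `θ k / t` are summable by the ratio test, hence bounded. -/
lemma exists_prod_le_of_tendsto_zero {θ : ℕ → ℝ} (hpos : ∀ p, 0 < θ p)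
    (hθ : Tendsto θ atTop (𝓝 0)) {t : ℝ} (ht : 0 < t) :
    ∃ C : ℝ, 0 < C ∧ ∀ p, ∏ k ∈ Finset.range p, θ k ≤ C * t ^ p := by
  have hP : ∀ p, 0 < ∏ k ∈ Finset.range p, θ k / t := fun p =>
    Finset.prod_pos fun k _ => div_pos (hpos k) ht
  have hs : Summable fun p => ∏ k ∈ Finset.range p, θ k / t := by
    refine summable_of_ratio_test_tendsto_lt_one (l := 0) one_pos
      (Eventually.of_forall fun p => (hP p).ne') ?_
    have : Tendsto (fun p => θ p / t) atTop (𝓝 0) := by simpa using hθ.div_const t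
    refine this.congr fun p => ?_
    rw [Real.norm_of_nonneg (hP _).le, Real.norm_of_nonneg (hP _).le, Finset.prod_range_succ,
      mul_div_cancel_left₀ _ (hP p).ne']
  obtain ⟨C, hC⟩ := hs.tendsto_atTop_zero.bddAbove_range
  have hC' : ∀ p, ∏ k ∈ Finset.range p, θ k / t ≤ C := fun p => hC ⟨p, rfl⟩
  refine ⟨C, (hP 0).trans_le (hC' 0), fun p => ?_⟩
  have := hC' p
  rwa [Finset.prod_div_distrib, Finset.prod_const, Finset.card_range,
    div_le_iff₀ (pow_pos ht p)] at this

/-! ### Surjectivity of the Borel map -/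

lemma IsWeightSequence.quotients_pos {M : ℕ → ℝ} (hM : IsWeightSequence M) (p : ℕ) :
    0 < quotients M p := div_pos (hM.pos _) (hM.pos _)

lemma IsWeightSequence.prod_quotients {M : ℕ → ℝ} (hM : IsWeightSequence M) (p : ℕ) :
    ∏ k ∈ Finset.range p, quotients M k = M p := by
  induction p with
  | zero => rw [Finset.range_zero, Finset.prod_empty, hM.zero]
  | succ p ih => rw [Finset.prod_range_succ, ih, quotients, mul_div_cancel₀ _ (hM.pos p).ne']

/-- A sequence `n` of the form `θ μ`, with `θ` tending to zero and `μ` bounded above and below by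
the quotients of `M`, that still majorizes a given series of the Beurling class. -/
lemma exists_smaller_quotients {M : ℕ → ℝ} (hM : IsWeightSequence M) {r γ : ℝ} (hr : 0 < r)
    (hγ : r < γ) (hinc : AlmostIncreasing fun p => quotients M p / ((p : ℝ) + 1) ^ γ)
    (hsm : HasShiftedMoments M) {F : PowerSeries ℂ} (hF : F ∈ beurlingSeries M) :
    ∃ n : ℕ → ℝ, (∀ p, 0 < n p) ∧
      (∃ κ : ℝ, 1 < κ ∧ ∀ p q : ℕ, p ≤ q →
        (n p / n q) ^ (1 / r) ≤ (((p : ℝ) + 1) / (q + 1)) ^ κ) ∧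
      (∃ C₀ H : ℝ, 0 ≤ C₀ ∧ 1 ≤ H ∧ ∀ p, Real.log (n (p + 1) / n p) ≤ C₀ * H ^ (p + 1)) ∧
      (∃ C : ℝ, ∀ p, ‖PowerSeries.coeff p F‖ ≤ C * ∏ k ∈ Finset.range p, n k) ∧
      ∀ t : ℝ, 0 < t → ∃ C : ℝ, 0 < C ∧ ∀ p, ∏ k ∈ Finset.range p, n k ≤ C * t ^ p * M p := by
  obtain ⟨a, ha, hinc⟩ := hinc
  obtain ⟨C₀, hC₀, H, hH, hsm⟩ := hsm
  set m := quotients M with hm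
  have hmpos : ∀ p, 0 < m p := hM.quotients_pos
  set μ := regularized m γ with hμdef
  have hμm : ∀ p, μ p ≤ m p := regularized_le hmpos γ
  have hmμ : ∀ p, m p ≤ a * μ p := le_mul_regularized ha hinc
  have hμpos : ∀ p, 0 < μ p := fun p => pos_of_mul_pos_right ((hmpos p).trans_le (hmμ p)) ha.le
  have hμprod : ∀ p, 0 < ∏ k ∈ Finset.range p, μ k := fun p => Finset.prod_pos fun k _ => hμpos k
  have hMμ : ∀ p, M p ≤ a ^ p * ∏ k ∈ Finset.range p, μ k := by
    intro p
    rw [← hM.prod_quotients p]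
    calc ∏ k ∈ Finset.range p, m k ≤ ∏ k ∈ Finset.range p, a * μ k :=
          Finset.prod_le_prod (fun k _ => (hmpos k).le) fun k _ => hmμ k
      _ = _ := by rw [Finset.prod_mul_distrib, Finset.prod_const, Finset.card_range]
  have hμM : ∀ p, ∏ k ∈ Finset.range p, μ k ≤ M p := by
    intro p
    rw [← hM.prod_quotients p]
    exact Finset.prod_le_prod (fun k _ => (hμpos k).le) fun k _ => hμm k
  -- `θ` may consume half of the gap between `r` and `γ`; the remaining exponent `γ - (γ - r) / 2`
  -- still exceeds `r`, so that `κ > 1`.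
  have hδ : 0 < (γ - r) / 2 := by linarith
  obtain ⟨θ, hθpos, hθanti, hθ0, hθδ, hθε⟩ := exists_slow_factors
    (ε := fun n => ‖PowerSeries.coeff n F‖ / ∏ k ∈ Finset.range n, μ k)
    (fun n => div_nonneg (norm_nonneg _) (hμprod n).le) (fun t ht => by
      -- Dividing by `a` compensates the factor `a ^ n` lost in passing from `M` to the products of
      -- `μ`.
      obtain ⟨C, hC⟩ := hF (t / a) (by positivity)
      have hC0 : 0 ≤ C := by
        have := (norm_nonneg _).trans (hC 0)
        simpa [hM.zero] using this
      refine ⟨C, fun n => ?_⟩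
      rw [div_le_iff₀ (hμprod n)]
      refine (hC n).trans ?_
      calc C * ((t / a) ^ n * M n) ≤ C * ((t / a) ^ n * (a ^ n * ∏ k ∈ Finset.range n, μ k)) := by
            gcongr
            exact hMμ n
        _ = C * t ^ n * ∏ k ∈ Finset.range n, μ k := by
            rw [div_pow]
            field_simp) hδ
  refine ⟨fun p => θ p * μ p, fun p => mul_pos (hθpos p) (hμpos p),
    ⟨(γ - (γ - r) / 2) / r, ?_, fun p q hpq => ?_⟩,
    ⟨|Real.log a| + C₀, H, by positivity, hH.le, fun p => ?_⟩,
    ⟨max 1 ‖PowerSeries.coeff 0 F‖, fun p => ?_⟩, fun t ht => ?_⟩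
  · rw [lt_div_iff₀ hr]
    linarith
  · have h1 : θ p * ((p : ℝ) + 1) ^ ((γ - r) / 2) ≤ θ q * ((q : ℝ) + 1) ^ ((γ - r) / 2) := hθδ hpq
    have h2 := regularized_div_le hmpos γ hpq
    have h3 : θ p * μ p / (θ q * μ q) ≤
        (((p : ℝ) + 1) / (q + 1)) ^ (γ - (γ - r) / 2) := by
      rw [Real.div_rpow (by positivity) (by positivity), Real.rpow_sub (by positivity),
        Real.rpow_sub (by positivity), div_le_div_iff₀ (mul_pos (hθpos q) (hμpos q))
          (by positivity)]
      rw [div_le_div_iff₀ (by positivity) (by positivity)] at h2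
      have hp1 : 0 < ((p : ℝ) + 1) ^ ((γ - r) / 2) := by positivity
      have hq1 : 0 < ((q : ℝ) + 1) ^ ((γ - r) / 2) := by positivity
      rw [mul_div_assoc', div_mul_eq_mul_div, div_le_div_iff₀ hq1 hp1]
      have h4 := mul_le_mul h1 h2 (mul_nonneg (hμpos p).le (by positivity))
        (mul_nonneg (hθpos q).le hq1.le)
      calc _ = θ p * ((p : ℝ) + 1) ^ ((γ - r) / 2) * (μ p * ((q : ℝ) + 1) ^ γ) := by ring
        _ ≤ _ := h4
        _ = _ := by ring
    calc (θ p * μ p / (θ q * μ q)) ^ (1 / r)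
        ≤ ((((p : ℝ) + 1) / (q + 1)) ^ (γ - (γ - r) / 2)) ^ (1 / r) :=
          Real.rpow_le_rpow (div_nonneg (mul_pos (hθpos p) (hμpos p)).le
            (mul_pos (hθpos q) (hμpos q)).le) h3 (by positivity)
      _ = _ := by
          rw [← Real.rpow_mul (by positivity), mul_one_div]
  -- As `θ` decreases, only the equivalence of `μ` and `m` can enlarge the jump, by `log a` at most.
  · have h1 : θ (p + 1) * μ (p + 1) / (θ p * μ p) ≤ a * (m (p + 1) / m p) := by
      rw [div_le_iff₀ (mul_pos (hθpos p) (hμpos p))]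
      have h2 : μ (p + 1) ≤ (m (p + 1) / m p) * (a * μ p) := by
        rw [div_mul_eq_mul_div, le_div_iff₀ (hmpos p)]
        exact mul_le_mul (hμm _) (hmμ p) (hmpos p).le (hmpos _).le
      calc θ (p + 1) * μ (p + 1) ≤ θ p * ((m (p + 1) / m p) * (a * μ p)) :=
            mul_le_mul (hθanti (Nat.le_succ p)) h2 (hμpos _).le (hθpos _).le
        _ = _ := by ring
    refine (Real.log_le_log (div_pos (mul_pos (hθpos _) (hμpos _))
      (mul_pos (hθpos _) (hμpos _))) h1).trans ?_
    rw [Real.log_mul ha.ne' (div_pos (hmpos _) (hmpos _)).ne', add_mul]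
    refine add_le_add ?_ (hsm p)
    exact (le_abs_self _).trans (le_mul_of_one_le_right (abs_nonneg _) (one_le_pow₀ hH.le))
  · cases p with
    | zero => simp
    | succ p =>
      have h1 := hθε p
      rw [div_le_iff₀ (hμprod _), ← Finset.prod_mul_distrib] at h1
      refine h1.trans (le_mul_of_one_le_left ?_ (le_max_left _ _))
      exact (Finset.prod_pos fun k _ => mul_pos (hθpos k) (hμpos k)).le
  · obtain ⟨C, hC, hCp⟩ := exists_prod_le_of_tendsto_zero hθpos hθ0 ht
    refine ⟨C, hC, fun p => ?_⟩
    rw [Finset.prod_mul_distrib]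
    exact mul_le_mul (hCp p) (hμM p) (hμprod p).le (by positivity)

theorem exists_function_with_expansion {M : ℕ → ℝ} (hM : IsWeightSequence M) {r γ : ℝ}
    (hr : 0 < r) (hγ : r < γ)
    (hinc : AlmostIncreasing fun p => quotients M p / ((p : ℝ) + 1) ^ γ)
    (hsm : HasShiftedMoments M) {F : PowerSeries ℂ} (hF : F ∈ beurlingSeries M) :
    ∃ f : LogSurface → ℂ, DifferentiableOn ℂ f (sector r) ∧
      ∀ h : ℝ, 0 < h → HasUniformExpansion M h (sector r) f F := by
  obtain ⟨n, hn, ⟨κ, hκ, hgrow⟩, ⟨C₀, H, hC₀, hH, hjump⟩, ⟨C, hC⟩, hsmall⟩ :=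
    exists_smaller_quotients hM hr hγ hinc hsm hF
  have hexp : ∀ p, Real.exp (∑ k ∈ Finset.range p, Real.log (n k)) =
      ∏ k ∈ Finset.range p, n k := fun p => by
    rw [Real.exp_sum]
    exact Finset.prod_congr rfl fun k _ => Real.exp_log (hn k)
  obtain ⟨f, hf, D, A, hD, hA, hfb⟩ := exists_expansion_of_growth hr hκ
    (l := fun k => Real.log (n k)) (fun p q hpq => by
      refine le_trans (le_of_eq ?_) (hgrow p q hpq)
      rw [Real.rpow_def_of_pos (div_pos (hn p) (hn q)), Real.log_div (hn p).ne' (hn q).ne',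
        mul_one_div]) hC₀ hH
    (fun p => by
      rw [← Real.log_div (hn _).ne' (hn _).ne']
      exact hjump p) (a := fun k => PowerSeries.coeff k F) (C := C) (fun p => by
      rw [hexp]
      exact hC p)
  refine ⟨f, hf, fun h hh => ?_⟩
  -- The smallness of `N` against `M` absorbs the fixed type `A` into any prescribed `h`.
  obtain ⟨K, hK, hKp⟩ := hsmall (h / A) (by positivity)
  refine ⟨D * K, by positivity, fun p w hw => (hfb p w hw).trans ?_⟩
  rw [hexp, LogSurface.modulus]
  calc D * A ^ p * (∏ k ∈ Finset.range p, n k) * Real.exp w.re ^ p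
      ≤ D * A ^ p * (K * (h / A) ^ p * M p) * Real.exp w.re ^ p := by
        gcongr
        exact hKp p
    _ = D * K * h ^ p * M p * Real.exp w.re ^ p := by
        rw [div_pow]
        field_simp

lemma exists_almostIncreasing {M : ℕ → ℝ} {r : ℝ} (h : ENNReal.ofReal r < gammaIndex M) :
    ∃ γ : ℝ, r < γ ∧ AlmostIncreasing fun p => quotients M p / ((p : ℝ) + 1) ^ γ := by
  obtain ⟨t, ⟨γ, hγ, hinc, rfl⟩, hlt⟩ := lt_sSup_iff.1 h
  exact ⟨γ, (ENNReal.ofReal_lt_ofReal_iff hγ).1 hlt, hinc⟩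

theorem surjective_borelMap {M : ℕ → ℝ} (hM : IsWeightSequence M) (hsm : HasShiftedMoments M)
    {r : ℝ} (hr : 0 < r) (h : ENNReal.ofReal r < gammaIndex M) :
    Function.Surjective (borelMap M r hr) := by
  rintro ⟨F, hF⟩
  obtain ⟨γ, hγ, hinc⟩ := exists_almostIncreasing h
  obtain ⟨f, hf, hfF⟩ := exists_function_with_expansion hM hr hγ hinc hsm hF
  have hmem : f ∈ beurlingClass M (sector r) := fun t ht => ⟨hf, F, hfF t ht⟩
  refine ⟨⟨f, hmem⟩, Subtype.ext ?_⟩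
  exact ((exists_expansion hr hmem).choose_spec 1 one_pos).unique hr (hfF 1 one_pos)

end

end Ultraholomorphic

theorem theorem4p10 (M : ℕ → ℝ) (hM : Ultraholomorphic.IsWeightSequence M)
    (hγ : 0 < Ultraholomorphic.gammaIndex M) (hsm : Ultraholomorphic.HasShiftedMoments M) :
    (∀ (r : ℝ) (hr : 0 < r), ENNReal.ofReal r < Ultraholomorphic.gammaIndex M →
      Function.Surjective (Ultraholomorphic.borelMap M r hr)) ∧
    {r : ℝ | 0 < r ∧ ENNReal.ofReal r < Ultraholomorphic.gammaIndex M} ⊆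
      Ultraholomorphic.surjectivityInterval M :=
  ⟨fun _ hr h => Ultraholomorphic.surjective_borelMap hM hsm hr h,
    fun _ hr => ⟨hr.1, Ultraholomorphic.surjective_borelMap hM hsm hr.1 hr.2⟩⟩
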